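/- **Theorem 1 (lower bound, fixed network).** There is an absolute constant $c>0$ such that the following holds. Let $\mu>0$, let $n\ge 1$ be an integer, let $\overline L\ge \sqrt n\,\mu$, $L=\overline L/\sqrt n$, $\chi\ge 1$, and let $K,N\ge 0$ be integers. Then for every sufficiently large $d$ there exist a number $M$ of workers, a connected undirected graph $G$ on $\{1,\dots,M\}$, a matrix $W\in\mathbb R^{M\times M}$, operators $F_{m,i}:\mathbb R^d\to\mathbb R^d$ ($1\le m\le M$, $1\le i\le n$) and a point $z^*\in\mathbb R^d$, $z^*\neq 0$, with the following properties. (i) $W$ is a gossip matrix of $G$ with characteristic number $\chi$: it is symmetric positive semidefinite, its kernel consists exactly of the constant vectors, $W_{ij}\ne 0$ if and only if $i=j$ or $\{i,j\}$ is an edge of $G$, its largest eigenvalue is $1$, and its smallest positive eigenvalue is $1/\chi$. (ii) Put $F_m=\frac1n\sum_{i=1}^n F_{m,i}$ and $F=\sum_{m=1}^M F_m$. Each $F_m$ is $L$-Lipschitz; for each $m$ the family $(F_{m,i})_i$ is $\overline L$-average Lipschitz, i.e. $\frac1n\sum_{i}\|F_{m,i}(u)-F_{m,i}(v)\|^2\le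 \overline L^2\|u-v\|^2$ for all $u,v$; each $F_m$ is strongly monotone (with some positive modulus), and $F$ is $\mu$-strongly monotone: $\langle F(u)-F(v),u-v\rangle\ge\mu\|u-v\|^2$ for all $u,v$. (iii) $z^*$ is the solution of the variational inequality $\langle F(z^*),z-z^*\rangle+g(z)-g(z^*)\ge 0$ for all $z\in\mathbb R^d$, with $g\equiv 0$. (iv) Every procedure of the following class, with at most $K$ communication rounds and at most $N$ local computations on each worker, has an output $\hat z$ with $$\mathbb E\|\hat z-z^*\|^2\ \ge\ c\,\exp\Big(-\frac{80}{1+\sqrt{2L^2/\mu^2+1}}\cdot\frac{K}{\sqrt\chi}\Big)R_0^2 \quad\text{and}\quad \mathbb E\|\hat z-z^*\|^2\ \ge\ c\,\exp\Big(-\frac{16}{n+\sqrt{2n\overline L^2/\mu^2+n^2}}\cdot N\Big)R_0^2,$$ where $R_0^2=\|z^0-z^*\|^2$ and $z^0=0$. *The class of procedures.* Worker $m$ has a memory $\mathcal M_m\subset\mathbb R^d$, initially $\{0\}$. The procedure makes finitely many iterations; each is either a communication round or a local iteration, and the choice, as well as the batch sizes, may depend on the past and on internal randomness. In a communication round each $\mathcal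 M_m$ is replaced by the linear span of the memories of $m$ and of its neighbours in $G$. In a local iteration every worker $m$ chooses a size $b_m\in\{0,\dots,n\}$, draws a batch $S_m\subset\{1,\dots,n\}$ that is uniform among the sets of size $b_m$ (independently of the other workers and of the past), and adds to $\mathcal M_m$ finitely many points, one after the other, each of the form $$z\in\operatorname{span}\Big\{z',\ \sum_{i\in S_m}F_{m,i}(z''),\ \operatorname{prox}_{\rho g}\big(\operatorname{span}\{z''',\ \textstyle\sum_{i\in S_m}F_{m,i}(z'')\}\big)\Big\},\qquad z',z'',z'''\in\mathcal M_m,\ \rho>0;$$ this costs worker $m$ $b_m$ local computations. Here $\operatorname{prox}_{\rho g}(w)=\arg\min_y\{\rho g(y)+\frac12\|y-w\|^2\}$. The output satisfies $\hat z\in\operatorname{span}\bigcup_m\mathcal M_m$. -/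

import Mathlib

open MeasureTheory
open scoped ENNReal

universe u

/-- The space `ℝ^d` with its Euclidean norm and inner product. -/
abbrev Rd (d : ℕ) : Type := EuclideanSpace ℝ (Fin d)

/-- A decentralized finite-sum variational inequality on `ℝ^d` with `M` workers and `n` components
per worker: find `z` with `⟪F z, y - z⟫ + g y - g z ≥ 0` for all `y`, where
`F = ∑ m, F_m`, `F_m = (1/n) ∑ i, F_{m,i}` and `g : ℝ^d → ℝ ∪ {+∞}` is proper, convex and lower
semicontinuous. `comp m i` is the operator `F_{m,i}`. -/
structure VIProblem (d M n : ℕ) where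
  comp : Fin M → Fin n → Rd d → Rd d
  g : Rd d → EReal
  g_ne_bot : ∀ z, g z ≠ ⊥
  g_proper : ∃ z, g z ≠ ⊤
  g_lsc : LowerSemicontinuous g
  g_convex : ∀ (x y : Rd d) (a b : ℝ), 0 ≤ a → 0 ≤ b → a + b = 1 →
    g (a • x + b • y) ≤ (a : EReal) * g x + (b : EReal) * g y

namespace VIProblem

variable {d M n : ℕ}

/-- The operator `F_m` of worker `m`. -/
noncomputable def node (P : VIProblem d M n) (m : Fin M) (z : Rd d) : Rd d :=
  (1 / (n : ℝ)) • ∑ i, P.comp m i z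

/-- The operator `F = ∑ m, F_m`. -/
noncomputable def total (P : VIProblem d M n) (z : Rd d) : Rd d :=
  ∑ m, P.node m z

/-- The answer `∑ i ∈ S, F_{m,i}(z)` of worker `m` for the batch `S`. -/
noncomputable def batchSum (P : VIProblem d M n) (m : Fin M) (S : Finset (Fin n)) (z : Rd d) :
    Rd d :=
  ∑ i ∈ S, P.comp m i z

/-- `z` solves the variational inequality. -/
def IsSolution (P : VIProblem d M n) (z : Rd d) : Prop :=
  P.g z ≠ ⊤ ∧ ∀ y : Rd d, P.g z ≤ ((inner ℝ (P.total z) (y - z) : ℝ) : EReal) + P.g y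

end VIProblem

/-- `‖F u - F v‖ ≤ L ‖u - v‖` for all `u, v`. -/
def IsLipschitzOp {d : ℕ} (L : ℝ) (F : Rd d → Rd d) : Prop :=
  ∀ u v : Rd d, ‖F u - F v‖ ≤ L * ‖u - v‖

/-- The finite family `F_1, …, F_n` is `L`-average Lipschitz. -/
def IsAverageLipschitz {d n : ℕ} (L : ℝ) (F : Fin n → Rd d → Rd d) : Prop :=
  ∀ u v : Rd d, (1 / (n : ℝ)) * ∑ i, ‖F i u - F i v‖ ^ 2 ≤ L ^ 2 * ‖u - v‖ ^ 2

/-- `⟪F u - F v, u - v⟫ ≥ μ ‖u - v‖ ^ 2` for all `u, v`. -/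
def IsStronglyMonotone {d : ℕ} (μ : ℝ) (F : Rd d → Rd d) : Prop :=
  ∀ u v : Rd d, μ * ‖u - v‖ ^ 2 ≤ inner ℝ (F u - F v) (u - v)

/-- A fixed network: `G` is a connected graph on the workers, and `W` is a gossip matrix for `G`
with largest eigenvalue `1` and smallest positive eigenvalue `1 / χ`, so that its characteristic
number is `χ`. -/
structure IsFixedNetwork {M : ℕ} (G : SimpleGraph (Fin M)) (W : Matrix (Fin M) (Fin M) ℝ) (χ : ℝ) :
    Prop where
  connected : G.Connected
  posSemidef : W.PosSemidef
  ker_eq : ∀ v : Fin M → ℝ, W.mulVec v = 0 ↔ ∃ a : ℝ, v = fun _ => a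
  support : ∀ i j, W i j ≠ 0 ↔ i = j ∨ G.Adj i j
  eig_max : IsGreatest (spectrum ℝ W) 1
  eig_min_pos : IsLeast {l : ℝ | l ∈ spectrum ℝ W ∧ 0 < l} (1 / χ)

/-- `p` is a value of `prox_{ρ g}` at `w`, that is, a minimizer of `ρ g(y) + ‖y - w‖² / 2`. -/
def IsProx {d : ℕ} (g : Rd d → EReal) (ρ : ℝ) (w p : Rd d) : Prop :=
  ∀ y : Rd d, (ρ : EReal) * g p + ((1 / 2 * ‖p - w‖ ^ 2 : ℝ) : EReal)
    ≤ (ρ : EReal) * g y + ((1 / 2 * ‖y - w‖ ^ 2 : ℝ) : EReal)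

/-- The points that one local computation may add to the local memory `A`, when `H` is the operator
`z ↦ ∑ i ∈ S, F_{m,i}(z)` of the sampled batch:
`z ∈ span {z', H z'', prox_{ρ g}(span {z''', H z''})}` with `z', z'', z''' ∈ A` and `ρ > 0`. -/
def Addable {d : ℕ} (g : Rd d → EReal) (H : Rd d → Rd d) (A : Set (Rd d)) : Set (Rd d) :=
  {z | ∃ z₁ ∈ A, ∃ z₂ ∈ A, ∃ z₃ ∈ A, ∃ ρ : ℝ, 0 < ρ ∧
    z ∈ Submodule.span ℝ ({z₁, H z₂} ∪
      {p | ∃ w ∈ Submodule.span ℝ ({z₃, H z₂} : Set (Rd d)), IsProx g ρ w p})}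

/-- The memory `A'` arises from `A` by adding finitely many points, one after the other, with the
same batch operator `H`. -/
def LocalUpdate {d : ℕ} (g : Rd d → EReal) (H : Rd d → Rd d) (A A' : Set (Rd d)) : Prop :=
  Relation.ReflTransGen (fun B B' : Set (Rd d) => ∃ z ∈ Addable g H B, B' = insert z B) A A'

/-- A (randomized, adaptive) procedure of the span-based oracle class for the problem `P` on the
network `G`, over a probability space `(Ω, ℙ)`, with at most `K` communication rounds and at most
`N` local computations on each worker.

`ℱ t` is the information available before iteration `t` (it may contain internal randomness of the
procedure); on the event `comm t` iteration `t` is a communication round, otherwise every worker `m`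
draws a batch `batch t m` of `size t m` components and does a local computation (size `0`: the
worker does not call its operators). `mem t m` is the memory of worker `m` before iteration `t`,
and `out` is the output after the `T` iterations. -/
structure Procedure {d M n : ℕ} (P : VIProblem d M n) (G : SimpleGraph (Fin M)) (K N : ℕ)
    (Ω : Type u) [mΩ : MeasurableSpace Ω] (ℙ : Measure Ω) where
  T : ℕ
  ℱ : Filtration ℕ mΩ
  comm : ℕ → Set Ω
  size : ℕ → Fin M → Ω → ℕ
  batch : ℕ → Fin M → Ω → Finset (Fin n)
  mem : ℕ → Fin M → Ω → Set (Rd d)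
  out : Ω → Rd d
  /-- The kind of an iteration and the batch sizes are decided before the iteration. -/
  comm_meas : ∀ t, MeasurableSet[ℱ t] (comm t)
  size_meas : ∀ t m b, MeasurableSet[ℱ t] {ω | size t m ω = b}
  /-- The batches become known with the iteration. -/
  batch_meas : ∀ t m s, MeasurableSet[ℱ (t + 1)] {ω | batch t m ω = s}
  out_meas : Measurable out
  size_comm : ∀ t m, ∀ ω ∈ comm t, size t m ω = 0
  batch_card : ∀ t m ω, (batch t m ω).card = size t m ω
  /-- Given the past, the batches of the workers are independent, and each is uniform among the
  sets of components of the prescribed size. -/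
  batch_uniform : ∀ t < T, ∀ A : Set Ω, MeasurableSet[ℱ t] A →
    ∀ s : Fin M → Finset (Fin n), (∀ ω ∈ A, ∀ m, size t m ω = (s m).card) →
      ℙ (A ∩ {ω | ∀ m, batch t m ω = s m}) * ∏ m, ((n.choose (s m).card : ℕ) : ℝ≥0∞) = ℙ A
  mem_zero : ∀ m ω, mem 0 m ω = {0}
  mem_local : ∀ t < T, ∀ ω, ω ∉ comm t → ∀ m,
    LocalUpdate P.g (P.batchSum m (batch t m ω)) (mem t m ω) (mem (t + 1) m ω)
  mem_comm : ∀ t < T, ∀ ω ∈ comm t, ∀ m,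
    mem (t + 1) m ω = Submodule.span ℝ (⋃ i ∈ {i : Fin M | i = m ∨ G.Adj i m}, mem t i ω)
  out_mem : ∀ ω, out ω ∈ Submodule.span ℝ (⋃ m, mem T m ω)
  /-- At most `K` communication rounds. -/
  comm_budget : ∀ ω, Set.ncard {t : ℕ | t < T ∧ ω ∈ comm t} ≤ K
  /-- At most `N` local computations on each worker; a batch of size `b` costs `b`. -/
  local_budget : ∀ m ω, ∑ t ∈ Finset.range T, size t m ω ≤ N

/-!
The hard operator is `F z = μ z + β (S₀ + S₁) z - (μ + β q) e₀` with `β = L / 2`. Here `S₀` and `S₁`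
rotate by a right angle in the coordinate planes `(j, j + 1)` with `j` even and with `j` odd. They
are monotone contractions (`inner_chainRotation_nonneg`, `norm_chainRotation_le`), so `F` is
`μ`-strongly monotone, and `F z = 0` is the recursion `β z_{j+1} + μ z_j = β z_{j-1}`, solved by the
geometric vector `z_j = q ^ j` with `q ≥ exp (-μ / L)` (`chain_equation`, `exists_chain_rate`). The
two ends of the network hold `S₀` and `S₁`, and of the `n` components of a worker only the component
`0` carries its share.

A memory supported on the first `k` coordinates is enlarged by at most one coordinate by repeated use
of one of the `S_p`, namely when `k` and `p` have different parity (`chainRotation_mem`). So the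
chain has to be extended alternately by the two ends. This limits the support of the output twice.

* If the ends are at distance `D`, each further coordinate takes `D` communication rounds: the output
  lies on the first `K / D + 2` coordinates (`Procedure.out_mem_of_rounds`).
* Each further coordinate takes a batch, drawn at one of the two ends, that contains the component
  `0`. A batch of size `b` does so with probability `b / n`, so the expected number of such batches
  is at most `2 N / n` (`Procedure.natCast_mul_lintegral_hits_le`), and Jensen's inequality turns
  this into a bound for the expected error (`ofReal_exp_le_lintegral`).

A vector supported on the first `k` coordinates has squared distance at least
`(q ^ (2 k) - q ^ (2 d)) ‖z*‖²` from `z*` (`norm_sub_geomVec_sq_ge`), and the second power is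
negligible in high dimension.

It remains to have a gossip matrix with exactly the characteristic number `χ` on a network with
`D ≥ √χ / 3` (`exists_network`). The Laplacian of the path with the weights
`(i + 1) (M - 1 - i) / 2` acts on the binomial polynomials `x ↦ x.choose k`, `k < M`, by a triangular
matrix with the diagonal entries `k (k + 1) / 2` (`pathLaplacian_mul_pascal`). So the spectrum of
each polynomial in it is known exactly (`det_quadratic_pathLaplacian`), and a quadratic polynomial
has enough freedom to move the largest and the smallest positive eigenvalue to `1` and `1 / χ`, while
it only halves the distance between the ends.
-/

/-! ### The chain operators -/

/-- The subspace of the vectors of `ℝ^d` supported on the first `k` coordinates. -/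
def headSubspace (d k : ℕ) : Submodule ℝ (Rd d) where
  carrier := {z | ∀ j : Fin d, k ≤ (j : ℕ) → z j = 0}
  add_mem' := by
    intro a b ha hb j hj
    simp [ha j hj, hb j hj]
  zero_mem' := by
    intro j _
    simp
  smul_mem' := by
    intro c x hx j hj
    simp [hx j hj]

lemma headSubspace_mono {d k l : ℕ} (h : k ≤ l) : headSubspace d k ≤ headSubspace d l :=
  fun _ hz j hj => hz j (h.trans hj)

/-- The matching of the path `0 - 1 - ⋯ - (d - 1)` formed by the edges `{j, j + 1}` with
`j % 2 = p`, as a map that exchanges matched coordinates and fixes the others. -/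
def chainPartner {d : ℕ} (p : ℕ) (j : Fin d) : Fin d :=
  if (j : ℕ) % 2 = p then (if h : (j : ℕ) + 1 < d then ⟨j + 1, h⟩ else j)
  else ⟨j - 1, by omega⟩

/-- The coefficient of `z (chainPartner p j)` in the coordinate `j` of `chainRotation d q p z`. -/
def chainCoeff (q : ℝ) (p : ℕ) {d : ℕ} (j : Fin d) : ℝ :=
  if (j : ℕ) % 2 = p then (if (j : ℕ) + 1 < d then 1 else q) else (if 0 < (j : ℕ) then -1 else 0)

/-- Rotation by a right angle in each of the coordinate planes `(j, j + 1)` with `j % 2 = p`. If the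
partner `d` of the last coordinate is missing, that coordinate is multiplied by `q`: for the
geometric vector `(q ^ j)` this is what the missing coordinate would contribute. -/
noncomputable def chainRotation (d : ℕ) (q : ℝ) (p : ℕ) : Rd d →ₗ[ℝ] Rd d where
  toFun z := WithLp.toLp 2 fun j => chainCoeff q p j * z (chainPartner p j)
  map_add' x y := by
    ext j
    simp [mul_add]
  map_smul' c x := by
    ext j
    simp only [PiLp.smul_apply, smul_eq_mul, RingHom.id_apply]
    ring

lemma chainRotation_apply {d : ℕ} (q : ℝ) (p : ℕ) (z : Rd d) (j : Fin d) :
    chainRotation d q p z j = chainCoeff q p j * z (chainPartner p j) := rfl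

lemma chainPartner_involutive {d p : ℕ} (hp : p < 2) :
    Function.Involutive (chainPartner p : Fin d → Fin d) := by
  intro j
  ext
  unfold chainPartner
  grind

lemma abs_chainCoeff_le {q : ℝ} (hq0 : 0 ≤ q) (hq1 : q ≤ 1) (p : ℕ) {d : ℕ} (j : Fin d) :
    |chainCoeff q p j| ≤ 1 := by
  unfold chainCoeff
  split_ifs <;> simp [abs_le]
  constructor <;> linarith

lemma chainCoeff_add_partner_nonneg {q : ℝ} (hq0 : 0 ≤ q) {p : ℕ} (hp : p < 2) {d : ℕ}
    (z : Rd d) (j : Fin d) :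
    0 ≤ (chainCoeff q p j + chainCoeff q p (chainPartner p j)) * (z j * z (chainPartner p j)) := by
  have key : chainPartner p j = j ∧ 0 ≤ chainCoeff q p j ∨
      chainCoeff q p j + chainCoeff q p (chainPartner p j) = 0 := by
    unfold chainCoeff chainPartner
    by_cases h1 : (j : ℕ) % 2 = p
    · by_cases h2 : (j : ℕ) + 1 < d
      · right
        have : ((j : ℕ) + 1) % 2 ≠ p := by omega
        simp [h1, h2, this]
      · left
        simp [h1, h2, hq0]
    · by_cases h2 : 0 < (j : ℕ)
      · right
        have h3 : ((j : ℕ) - 1) % 2 = p := by omega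
        have h4 : (j : ℕ) - 1 + 1 < d := by omega
        simp [h1, h2, h3, h4]
      · left
        refine ⟨?_, by simp [h1, h2]⟩
        rw [if_neg h1]
        ext
        simp only
        omega
  rcases key with ⟨h1, h2⟩ | h
  · rw [h1]
    exact mul_nonneg (by linarith) (mul_self_nonneg _)
  · rw [h, zero_mul]

lemma norm_chainRotation_le {q : ℝ} (hq0 : 0 ≤ q) (hq1 : q ≤ 1) {p : ℕ} (hp : p < 2) {d : ℕ}
    (z : Rd d) : ‖chainRotation d q p z‖ ≤ ‖z‖ := by
  rw [EuclideanSpace.norm_eq, EuclideanSpace.norm_eq]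
  apply Real.sqrt_le_sqrt
  rw [← Equiv.sum_comp (chainPartner_involutive hp).toPerm (fun j => ‖z j‖ ^ 2)]
  refine Finset.sum_le_sum fun j _ => ?_
  rw [chainRotation_apply, norm_mul, mul_pow]
  have h := abs_chainCoeff_le hq0 hq1 p j
  have h2 : ‖chainCoeff q p j‖ ^ 2 ≤ 1 := pow_le_one₀ (norm_nonneg _) h
  exact mul_le_of_le_one_left (sq_nonneg _) h2

lemma inner_chainRotation_nonneg {q : ℝ} (hq0 : 0 ≤ q) {p : ℕ} (hp : p < 2) {d : ℕ}
    (z : Rd d) : 0 ≤ inner ℝ (chainRotation d q p z) z := by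
  have h1 : inner ℝ (chainRotation d q p z) z
      = ∑ j, chainCoeff q p j * (z j * z (chainPartner p j)) := by
    rw [PiLp.inner_apply]
    refine Finset.sum_congr rfl fun j _ => ?_
    simp only [chainRotation_apply, RCLike.inner_apply, conj_trivial]
    ring
  -- Reindexing along the matching pairs each coefficient with that of the partner.
  have h2 : ∑ j, chainCoeff q p j * (z j * z (chainPartner p j))
      = ∑ j, chainCoeff q p (chainPartner p j) * (z j * z (chainPartner p j)) := by
    rw [← Equiv.sum_comp (chainPartner_involutive hp).toPerm]
    refine Finset.sum_congr rfl fun j _ => ?_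
    simp only [Function.Involutive.coe_toPerm, chainPartner_involutive hp j]
    ring
  have h3 : 0 ≤ ∑ j, (chainCoeff q p j + chainCoeff q p (chainPartner p j)) *
      (z j * z (chainPartner p j)) :=
    Finset.sum_nonneg fun j _ => chainCoeff_add_partner_nonneg hq0 hp z j
  simp only [add_mul, Finset.sum_add_distrib] at h3
  rw [← h2, ← h1] at h3
  linarith

/-- `chainRotation d q p` leaves invariant every head subspace that contains no half of a matched
pair, that is, every one whose dimension has the parity `p`. -/
lemma chainRotation_mem {d k p : ℕ} {q : ℝ} (hk : k % 2 = p) {z : Rd d}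
    (hz : z ∈ headSubspace d k) : chainRotation d q p z ∈ headSubspace d k := by
  intro j hj
  rw [chainRotation_apply]
  have : k ≤ (chainPartner p j : ℕ) := by
    unfold chainPartner
    grind
  rw [hz _ this, mul_zero]

/-- The geometric vector `(1, q, q², …)`. -/
noncomputable def geomVec (d : ℕ) (q : ℝ) : Rd d := WithLp.toLp 2 fun j => q ^ (j : ℕ)

/-- The first basis vector. -/
noncomputable def firstVec (d : ℕ) : Rd d := WithLp.toLp 2 fun j => if (j : ℕ) = 0 then 1 else 0

lemma firstVec_mem {d k : ℕ} (hk : 1 ≤ k) : firstVec d ∈ headSubspace d k := by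
  intro j hj
  have : (j : ℕ) ≠ 0 := by omega
  simp [firstVec, this]

/-- The geometric vector solves `μ z + β (S₀ + S₁) z = (μ + β q) e₀` when `q` is a root of
`β q² + μ q = β`. -/
lemma chain_equation {d : ℕ} {q μ β : ℝ} (h : β * q ^ 2 + μ * q = β) :
    μ • geomVec d q + β • (chainRotation d q 0 (geomVec d q) + chainRotation d q 1 (geomVec d q))
      - (μ + β * q) • firstVec d = 0 := by
  ext j
  have hfwd : (if (j : ℕ) + 1 < d then (1 : ℝ) else q) *
      q ^ ((if h : (j : ℕ) + 1 < d then (⟨j + 1, h⟩ : Fin d) else j : Fin d) : ℕ)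
      = q ^ ((j : ℕ) + 1) := by
    split_ifs <;> simp [pow_succ, mul_comm]
  have hsum : chainRotation d q 0 (geomVec d q) j + chainRotation d q 1 (geomVec d q) j
      = q ^ ((j : ℕ) + 1) - (if 0 < (j : ℕ) then q ^ ((j : ℕ) - 1) else 0) := by
    simp only [chainRotation_apply, geomVec]
    rw [← hfwd]
    unfold chainCoeff chainPartner
    rcases Nat.mod_two_eq_zero_or_one (j : ℕ) with h0 | h0
    · simp only [h0, if_true, zero_ne_one, if_false]
      split_ifs <;> ring
    · simp only [h0, if_true, one_ne_zero, if_false]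
      split_ifs <;> ring
  simp only [PiLp.sub_apply, PiLp.add_apply, PiLp.smul_apply, smul_eq_mul, hsum, PiLp.zero_apply]
  simp only [geomVec, firstVec]
  rcases Nat.eq_zero_or_pos (j : ℕ) with h0 | h0
  · simp [h0]
  · obtain ⟨i, hi⟩ : ∃ i, (j : ℕ) = i + 1 := ⟨j - 1, by omega⟩
    simp only [hi, Nat.succ_pos, if_true, Nat.add_sub_cancel, Nat.succ_ne_zero, if_false]
    linear_combination q ^ i * h

lemma norm_geomVec_sq (d : ℕ) (q : ℝ) :
    ‖geomVec d q‖ ^ 2 = ∑ j ∈ Finset.range d, (q ^ 2) ^ j := by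
  rw [EuclideanSpace.norm_sq_eq, ← Fin.sum_univ_eq_sum_range (fun j => (q ^ 2) ^ j)]
  refine Finset.sum_congr rfl fun j _ => ?_
  rw [Real.norm_eq_abs, sq_abs]
  exact pow_right_comm q j 2

/-- A vector supported on the first `k` coordinates misses the tail of the geometric vector. -/
lemma norm_sub_geomVec_sq_ge {d k : ℕ} {q : ℝ} (hq0 : 0 < q) (hq1 : q < 1) {x : Rd d}
    (hx : x ∈ headSubspace d k) :
    ((q ^ 2) ^ k - (q ^ 2) ^ d) * ‖geomVec d q‖ ^ 2 ≤ ‖x - geomVec d q‖ ^ 2 := by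
  set r := q ^ 2 with hr
  have hr0 : 0 < r := by positivity
  have hr1 : r < 1 := by rw [hr]; nlinarith
  rcases le_or_gt d k with hdk | hkd
  · have : r ^ k ≤ r ^ d := pow_le_pow_of_le_one hr0.le hr1.le hdk
    exact (mul_nonpos_of_nonpos_of_nonneg (by linarith) (sq_nonneg _)).trans (sq_nonneg _)
  · have h1 : ∑ j ∈ Finset.Ico k d, r ^ j ≤ ‖x - geomVec d q‖ ^ 2 := by
      rw [EuclideanSpace.norm_sq_eq]
      have : ∑ j ∈ Finset.Ico k d, r ^ j
          = ∑ j : Fin d, if k ≤ (j : ℕ) then r ^ (j : ℕ) else 0 := by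
        rw [Fin.sum_univ_eq_sum_range (fun j => if k ≤ j then r ^ j else 0) d,
          ← Finset.sum_filter]
        refine Finset.sum_congr ?_ fun _ _ => rfl
        ext j
        simp [and_comm]
      rw [this]
      refine Finset.sum_le_sum fun j _ => ?_
      split_ifs with hj
      · have : x j = 0 := hx j hj
        rw [Real.norm_eq_abs, sq_abs, PiLp.sub_apply, this, zero_sub, neg_sq]
        exact (pow_right_comm q 2 j).le
      · positivity
    refine le_trans ?_ h1
    rw [norm_geomVec_sq, geom_sum_Ico' hr1.ne hkd.le, geom_sum_eq hr1.ne]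
    have h1r : 0 < 1 - r := by linarith
    have h2 : (r ^ d - 1) / (r - 1) = (1 - r ^ d) / (1 - r) := by
      rw [← neg_div_neg_eq]; ring
    rw [h2, ← mul_div_assoc]
    gcongr
    have h3 : r ^ d ≤ r ^ k := pow_le_pow_of_le_one hr0.le hr1.le hkd.le
    have h4 : 0 ≤ r ^ d := by positivity
    nlinarith

/-- The decay rate of the solution of the chain problem with parameters `μ` and `L / 2`. -/
lemma exists_chain_rate {μ L : ℝ} (hμ : 0 < μ) (hL : μ ≤ L) :
    ∃ q : ℝ, 0 < q ∧ q < 1 ∧ L / 2 * q ^ 2 + μ * q = L / 2 ∧ Real.exp (-(μ / L)) ≤ q := by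
  have hL0 : 0 < L := hμ.trans_le hL
  set h := μ / L with hh
  have h0 : 0 < h := by positivity
  set s := Real.sqrt (1 + h ^ 2) with hs
  have hs2 : s ^ 2 = 1 + h ^ 2 := Real.sq_sqrt (by positivity)
  have hs0 : 0 ≤ s := Real.sqrt_nonneg _
  have hsh : h < s := by nlinarith
  have hs1 : s < 1 + h := by nlinarith
  refine ⟨s - h, by linarith, by linarith, ?_, ?_⟩
  · have : μ = h * L := by rw [hh]; field_simp
    rw [this]
    nlinarith
  · have he := Real.quadratic_le_exp_of_nonneg h0.le
    have hs3 : s ≤ 1 + h ^ 2 / 2 := by nlinarith [sq_nonneg (h ^ 2)]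
    have : (s - h) * (s + h) = 1 := by nlinarith
    rw [Real.exp_neg, inv_le_iff_one_le_mul₀ (Real.exp_pos _), ← this]
    exact mul_le_mul_of_nonneg_left (by linarith) (by linarith)

/-! ### Gossip matrices on a path -/

/-- The coefficient of the edge `{i, i + 1}` in `pathLaplacian`. -/
noncomputable def pathWeight (M i : ℕ) : ℝ := (i + 1) * (M - 1 - i) / 2

/-- The Laplacian of the path on `M` vertices with the weights `(i + 1) (M - 1 - i) / 2`. It is the
operator of which the discrete Chebyshev (Gram) polynomials are the eigenvectors. -/
noncomputable def pathLaplacian (M : ℕ) : Matrix (Fin M) (Fin M) ℝ := fun i j =>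
  (if (j : ℕ) = i then pathWeight M i + i * (M - i) / 2 else 0)
    + (if (j : ℕ) = i + 1 then -pathWeight M i else 0)
    + (if (i : ℕ) = j + 1 then -pathWeight M j else 0)

/-- The matrix of `pathLaplacian` in the basis `x ↦ x.choose k`. -/
noncomputable def pathTriangular (M : ℕ) : Matrix (Fin M) (Fin M) ℝ := fun j k =>
  (if (j : ℕ) = k then (k * (k + 1) / 2 : ℝ) else 0)
    + (if (k : ℕ) = j + 1 then -(k * (M - k) / 2 : ℝ) else 0)

/-- The Pascal matrix. -/
def pascalMatrix (M : ℕ) : Matrix (Fin M) (Fin M) ℝ := fun j k => ((j : ℕ).choose k : ℝ)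

lemma sum_ite_val_eq {M : ℕ} (a : ℕ) (f : ℕ → ℝ) :
    ∑ j : Fin M, (if (j : ℕ) = a then f j else 0) = if a < M then f a else 0 := by
  rw [Fin.sum_univ_eq_sum_range (fun j => if j = a then f j else 0)]
  simp [Finset.sum_ite_eq']

lemma pathLaplacian_sum {M : ℕ} (f : ℕ → ℝ) (i : Fin M) :
    ∑ j, pathLaplacian M i j * f j
      = pathWeight M i * (f i - f (i + 1)) + i * (M - i) / 2 * (f i - f (i - 1)) := by
  have h1 : ∀ j : Fin M, pathLaplacian M i j * f j
      = (if (j : ℕ) = i then (pathWeight M i + i * (M - i) / 2) * f j else 0)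
        + (if (j : ℕ) = i + 1 then -pathWeight M i * f j else 0)
        + (if (j : ℕ) = i - 1 then -(i * (M - i) / 2) * f j else 0) := by
    intro j
    have h2 : (if (i : ℕ) = j + 1 then -pathWeight M j else 0) * f j
        = (if (j : ℕ) = i - 1 then -(i * (M - i) / 2 : ℝ) * f j else 0) := by
      by_cases h : (i : ℕ) = j + 1
      · have h' : (j : ℕ) = i - 1 := by omega
        have h'' : ((i : ℕ) : ℝ) = j + 1 := by exact_mod_cast h
        rw [if_pos h, if_pos h', h'', pathWeight]
        ring
      · by_cases h' : (j : ℕ) = i - 1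
        · have h0 : (i : ℕ) = 0 := by omega
          simp [h0]
        · simp [h, h']
    rw [← h2]
    simp only [pathLaplacian, add_mul, ite_mul, zero_mul]
  simp only [h1, Finset.sum_add_distrib]
  rw [sum_ite_val_eq _ fun j => (pathWeight M i + i * (M - i) / 2) * f j,
    sum_ite_val_eq _ fun j => -pathWeight M i * f j,
    sum_ite_val_eq _ fun j => -(i * (M - i) / 2 : ℝ) * f j]
  have hi := i.isLt
  rw [if_pos hi, if_pos (show (i : ℕ) - 1 < M by omega)]
  split_ifs with h
  · ring
  · have hM : (M : ℝ) = i + 1 := by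
      have : M = (i : ℕ) + 1 := by omega
      exact_mod_cast this
    rw [pathWeight, hM]
    ring

lemma pathLaplacian_choose (M i k : ℕ) :
    pathWeight M i * ((i.choose k : ℝ) - (i + 1).choose k)
        + i * (M - i) / 2 * ((i.choose k : ℝ) - (i - 1).choose k)
      = k * (k + 1) / 2 * i.choose k - k * (M - k) / 2 * i.choose (k - 1) := by
  rcases k with _ | k
  · simp
  have h1 : ((i : ℝ) + 1) * i.choose k = (k + 1) * (i.choose k + i.choose (k + 1)) := by
    have := Nat.add_one_mul_choose_eq i k
    rw [Nat.choose_succ_succ] at this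
    have h : (((i + 1) * i.choose k : ℕ) : ℝ) = ((i.choose k + i.choose (k + 1)) * (k + 1) : ℕ) := by
      rw [this]
    push_cast at h
    linarith
  have h2 : (i : ℝ) * ((i.choose (k + 1) : ℝ) - (i - 1).choose (k + 1))
      = (k + 1) * i.choose (k + 1) := by
    rcases i with _ | i
    · simp
    · have := Nat.add_one_mul_choose_eq i k
      have h : (((i + 1) * i.choose k : ℕ) : ℝ) = ((i + 1).choose (k + 1) * (k + 1) : ℕ) := by
        rw [this]
      have h3 : (((i + 1).choose (k + 1) : ℕ) : ℝ) = (i.choose k + i.choose (k + 1) : ℕ) := by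
        rw [Nat.choose_succ_succ]
      push_cast at h h3 ⊢
      linear_combination h + (i + 1 : ℝ) * h3
  have h3 : (((i + 1).choose (k + 1) : ℕ) : ℝ) = i.choose k + i.choose (k + 1) := by
    rw [Nat.choose_succ_succ]; push_cast; ring
  rw [h3, pathWeight, Nat.add_sub_cancel]
  push_cast
  linear_combination (M - 1 - i - (k + 1) - ((M : ℝ) - 1 - i) + (k + 1)) * h1
    - ((M : ℝ) - 1 - i) / 2 * h1 + ((M : ℝ) - i) / 2 * h2 + (k + 1 : ℝ) / 2 * h1

lemma pathLaplacian_mul_pascal (M : ℕ) :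
    pathLaplacian M * pascalMatrix M = pascalMatrix M * pathTriangular M := by
  ext i k
  rw [Matrix.mul_apply, Matrix.mul_apply]
  have h1 := pathLaplacian_sum (M := M) (fun j => (j.choose k : ℝ)) i
  simp only [pascalMatrix] at h1 ⊢
  rw [h1, pathLaplacian_choose]
  have h2 : ∀ j : Fin M, ((i : ℕ).choose j : ℝ) * pathTriangular M j k
      = (if (j : ℕ) = k then (k * (k + 1) / 2 : ℝ) * (i : ℕ).choose j else 0)
        + (if (j : ℕ) = k - 1 then -(k * (M - k) / 2 : ℝ) * (i : ℕ).choose j else 0) := by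
    intro j
    unfold pathTriangular
    by_cases hk : (k : ℕ) = 0
    · by_cases hj : (j : ℕ) = 0 <;> simp [hk, hj]
    · have h : (k : ℕ) = j + 1 ↔ (j : ℕ) = k - 1 := by omega
      simp only [h, mul_add, mul_ite, mul_zero]
      simp only [mul_comm]
  simp only [h2, Finset.sum_add_distrib]
  rw [sum_ite_val_eq _ fun j => (k * (k + 1) / 2 : ℝ) * (i : ℕ).choose j,
    sum_ite_val_eq _ fun j => -(k * (M - k) / 2 : ℝ) * (i : ℕ).choose j,
    if_pos k.isLt, if_pos (show (k : ℕ) - 1 < M by omega)]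
  ring

lemma det_pascalMatrix (M : ℕ) : (pascalMatrix M).det = 1 := by
  rw [Matrix.det_of_isLowerTriangular]
  · simp [pascalMatrix]
  · intro i j hij
    have : (i : ℕ) < j := by simpa using hij
    simp [pascalMatrix, Nat.choose_eq_zero_of_lt this]

/-- The Pascal matrix triangularizes the path Laplacian, with the diagonal entries `k (k + 1) / 2`.
Hence the determinant of a polynomial in the Laplacian is the product of its values there. -/
lemma det_quadratic_pathLaplacian (M : ℕ) (a b c : ℝ) :
    (a • (1 : Matrix (Fin M) (Fin M) ℝ) + b • pathLaplacian M
        + c • (pathLaplacian M * pathLaplacian M)).det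
      = ∏ k : Fin M, (a + b * (k * (k + 1) / 2) + c * (k * (k + 1) / 2) ^ 2) := by
  set T := pathLaplacian M
  set B := pascalMatrix M
  set U := pathTriangular M with hU
  have hTB : T * B = B * U := pathLaplacian_mul_pascal M
  have hUlt : ∀ i j : Fin M, j < i → U i j = 0 := by
    intro i j hij
    have : (j : ℕ) < i := hij
    simp only [hU, pathTriangular]
    rw [if_neg (by omega), if_neg (by omega), add_zero]
  have hUd : ∀ k : Fin M, U k k = k * (k + 1) / 2 := by
    intro k
    simp [hU, pathTriangular]
  have htri : U.BlockTriangular id := fun i j hij => hUlt i j hij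
  have h1 : (a • (1 : Matrix (Fin M) (Fin M) ℝ) + b • T + c • (T * T)) * B
      = B * (a • (1 : Matrix (Fin M) (Fin M) ℝ) + b • U + c • (U * U)) := by
    simp only [add_mul, mul_add, Matrix.smul_mul, Matrix.mul_smul, Matrix.one_mul, Matrix.mul_one]
    rw [Matrix.mul_assoc, hTB, ← Matrix.mul_assoc, hTB, Matrix.mul_assoc]
  have h2 := congrArg Matrix.det h1
  rw [Matrix.det_mul, Matrix.det_mul, det_pascalMatrix, mul_one, one_mul] at h2
  rw [h2, Matrix.det_of_isUpperTriangular]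
  · refine Finset.prod_congr rfl fun k _ => ?_
    have hsq : (U * U) k k = U k k ^ 2 := by
      rw [Matrix.mul_apply, Finset.sum_eq_single k, sq]
      · intro j _ hj
        rcases lt_or_gt_of_ne hj with h | h
        · rw [hUlt k j h, zero_mul]
        · rw [hUlt j k h, mul_zero]
      · simp
    simp [hsq, hUd]
  · refine Matrix.BlockTriangular.add (Matrix.BlockTriangular.add ?_ ?_) ?_
    · exact fun i j hij => by simp [Matrix.one_apply_ne (show i ≠ j from (ne_of_lt hij).symm)]
    · exact fun i j hij => by simp [htri hij]
    · exact fun i j hij => by simp [Matrix.BlockTriangular.mul htri htri hij]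

lemma pathLaplacian_isSymm (M : ℕ) : (pathLaplacian M).transpose = pathLaplacian M := by
  ext i j
  rw [Matrix.transpose_apply]
  unfold pathLaplacian
  by_cases h : (i : ℕ) = j
  · rw [h]
  · have h' : ¬ (j : ℕ) = i := fun e => h e.symm
    simp only [h, h', if_false]
    ring

lemma pathLaplacian_eq_zero_of_lt {M : ℕ} {i j : Fin M}
    (h : (i : ℕ) + 1 < j ∨ (j : ℕ) + 1 < i) : pathLaplacian M i j = 0 := by
  unfold pathLaplacian
  rw [if_neg (by omega), if_neg (by omega), if_neg (by omega)]
  simp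

lemma pathLaplacian_mulVec_const {M : ℕ} (a : ℝ) :
    (pathLaplacian M).mulVec (fun _ => a) = 0 := by
  ext i
  have := pathLaplacian_sum (M := M) (fun _ => a) i
  simp only [sub_self, mul_zero, add_zero] at this
  exact this

lemma const_of_pathLaplacian_mulVec {M : ℕ} (hM : 0 < M) {v : Fin M → ℝ}
    (hv : (pathLaplacian M).mulVec v = 0) : v = fun _ => v ⟨0, hM⟩ := by
  set f : ℕ → ℝ := fun j => if h : j < M then v ⟨j, h⟩ else 0 with hf
  have hfv : ∀ j : Fin M, f j = v j := fun j => by simp [hf]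
  have hrow : ∀ i : Fin M,
      pathWeight M i * (f i - f (i + 1)) + i * (M - i) / 2 * (f i - f (i - 1)) = 0 := by
    intro i
    rw [← pathLaplacian_sum]
    simp only [hfv]
    exact congrFun hv i
  have key : ∀ j, j < M → f j = f 0 ∧ f (j - 1) = f 0 := by
    intro j
    induction j with
    | zero => intro _; simp
    | succ j ih =>
      intro hj
      obtain ⟨h1, h2⟩ := ih (by omega)
      have h := hrow ⟨j, by omega⟩
      simp only [h1, h2, sub_self, mul_zero, add_zero] at h
      have hw : 0 < pathWeight M j := by
        have : ((j + 1 : ℕ) : ℝ) < M := by exact_mod_cast hj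
        push_cast at this
        unfold pathWeight
        have : (0 : ℝ) < M - 1 - j := by linarith
        positivity
      rcases mul_eq_zero.1 h with h | h
      · exact absurd h hw.ne'
      · exact ⟨by linarith, by simpa using h1⟩
  funext j
  rw [← hfv, ← hfv, (key j j.isLt).1]

/-- Every symmetric positive semidefinite matrix whose kernel consists of the constant vectors is
supported on a connected graph. -/
lemma exists_isFixedNetwork {M : ℕ} (hM : 2 ≤ M) {W : Matrix (Fin M) (Fin M) ℝ} {χ : ℝ}
    (hpos : W.PosSemidef) (hker : ∀ v : Fin M → ℝ, W.mulVec v = 0 ↔ ∃ a : ℝ, v = fun _ => a)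
    (hmax : IsGreatest (spectrum ℝ W) 1)
    (hmin : IsLeast {l : ℝ | l ∈ spectrum ℝ W ∧ 0 < l} (1 / χ)) :
    ∃ G : SimpleGraph (Fin M), IsFixedNetwork G W χ := by
  have hsymm : ∀ i j, W i j = W j i := fun i j => by
    have := hpos.isHermitian.apply i j
    simpa using this.symm
  let G : SimpleGraph (Fin M) :=
    { Adj := fun i j => i ≠ j ∧ W i j ≠ 0
      symm := ⟨fun i j h => ⟨h.1.symm, by rw [hsymm]; exact h.2⟩⟩
      loopless := ⟨fun i h => h.1 rfl⟩ }
  have hdiag : ∀ i, W i i ≠ 0 := by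
    intro i hi
    have h1 : W.mulVec (Pi.single i 1) = 0 := by
      rw [← hpos.dotProduct_mulVec_zero_iff]
      simp [hi]
    obtain ⟨a, ha⟩ := (hker _).1 h1
    obtain ⟨j, hj⟩ : ∃ j : Fin M, j ≠ i := by
      have : Nontrivial (Fin M) := Fin.nontrivial_iff_two_le.2 hM
      exact exists_ne i
    have e1 := congrFun ha i
    have e2 := congrFun ha j
    rw [Pi.single_eq_same] at e1
    rw [Pi.single_eq_of_ne hj] at e2
    linarith
  refine ⟨G, ?_, hpos, hker, ?_, hmax, hmin⟩
  · -- The indicator of a connected component is in the kernel.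
    classical
    have hne : Nonempty (Fin M) := ⟨⟨0, by omega⟩⟩
    refine { preconnected := fun i => ?_, nonempty := hne }
    have h1 : W.mulVec (fun j => if G.Reachable i j then (1 : ℝ) else 0) = 0 := by
      funext a
      have hone : W.mulVec (fun _ => (1 : ℝ)) = 0 := (hker _).2 ⟨1, rfl⟩
      have hstep : ∀ b, W a b ≠ 0 → (G.Reachable i a ↔ G.Reachable i b) := by
        intro b hb
        by_cases hab : a = b
        · rw [hab]
        · have hadj : G.Adj a b := ⟨hab, hb⟩
          exact ⟨fun h => h.trans hadj.reachable, fun h => h.trans hadj.symm.reachable⟩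
      by_cases ha : G.Reachable i a
      · rw [← hone]
        simp only [Matrix.mulVec, dotProduct]
        refine Finset.sum_congr rfl fun b _ => ?_
        by_cases hb : W a b = 0
        · simp [hb]
        · simp [(hstep b hb).1 ha]
      · simp only [Matrix.mulVec, dotProduct]
        refine Finset.sum_eq_zero fun b _ => ?_
        by_cases hb : W a b = 0
        · simp [hb]
        · rw [if_neg fun h => ha ((hstep b hb).2 h), mul_zero]
    obtain ⟨c, hc⟩ := (hker _).1 h1
    intro j
    have e1 := congrFun hc i
    have e2 := congrFun hc j
    simp only [SimpleGraph.Reachable.refl, if_true] at e1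
    by_contra hj
    rw [if_neg hj] at e2
    linarith
  · intro i j
    by_cases hij : i = j
    · subst hij
      simp [hdiag i]
    · simp [G, hij]

/-- A gossip matrix of every prescribed characteristic number `χ ≥ 1` on a network whose diameter
is of the order `√χ`. It is a quadratic polynomial in the path Laplacian: the number `M` of vertices
is chosen with `χ ≈ M (M - 1) / 2`, the characteristic number of the Laplacian itself, and the
coefficients correct the eigenvalues to the exact values. -/
lemma exists_network (χ : ℝ) (hχ : 1 ≤ χ) :
    ∃ (M : ℕ) (G : SimpleGraph (Fin M)) (W : Matrix (Fin M) (Fin M) ℝ),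
      3 ≤ M ∧ IsFixedNetwork G W χ ∧ (∀ i j, G.Adj i j → (i : ℕ) ≤ j + 2) ∧
        χ ≤ 9 * ((M / 2 : ℕ) : ℝ) ^ 2 := by
  obtain ⟨M, hM3, hMlow, hMup⟩ : ∃ M : ℕ, 3 ≤ M ∧ (M = 3 ∨ (M * (M - 1) / 2 : ℝ) ≤ χ) ∧
      χ < M * (M + 1) / 2 := by
    have hex : ∃ m : ℕ, χ < (m + 3 : ℕ) * ((m + 3 : ℕ) + 1) / 2 := by
      obtain ⟨m, hm⟩ := exists_nat_gt χ
      refine ⟨m, ?_⟩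
      push_cast
      have : (0 : ℝ) ≤ m := m.cast_nonneg
      nlinarith
    classical
    refine ⟨Nat.find hex + 3, by omega, ?_, Nat.find_spec hex⟩
    rcases Nat.eq_zero_or_pos (Nat.find hex) with h | h
    · left; omega
    · right
      have := Nat.find_min hex (m := Nat.find hex - 1) (by omega)
      have e : Nat.find hex - 1 + 3 = Nat.find hex + 2 := by omega
      rw [e, not_lt] at this
      push_cast at this ⊢
      linarith
  have hMR : (3 : ℝ) ≤ M := by exact_mod_cast hM3
  set Λ : ℝ := M * (M - 1) / 2 with hΛ
  have hΛ3 : 3 ≤ Λ := by rw [hΛ]; nlinarith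
  have hχ0 : 0 < χ := by linarith
  have hχup : χ < Λ ^ 2 := by
    refine hMup.trans_le ?_
    have h1 : (M : ℝ) * (M + 1) / 2 ≤ 3 * Λ := by rw [hΛ]; nlinarith
    nlinarith
  set β : ℝ := (1 - Λ / χ) / (Λ * (Λ - 1)) with hβ
  set α : ℝ := 1 / χ - β with hα
  have hΛ1 : 0 < Λ * (Λ - 1) := by nlinarith
  have hαβ : α + β = 1 / χ := by rw [hα]; ring
  have hΛone : α * Λ + β * Λ ^ 2 = 1 := by
    have : β * (Λ * (Λ - 1)) = 1 - Λ / χ := div_mul_cancel₀ _ hΛ1.ne'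
    rw [hα]
    linear_combination this
  have hα0 : 0 < α := by
    have h : α * (χ * (Λ * (Λ - 1))) = Λ ^ 2 - χ := by
      have h1 : α * χ = 1 - β * χ := by rw [hα]; field_simp
      have h2 : β * (Λ * (Λ - 1)) * χ = χ - Λ := by
        rw [hβ, div_mul_cancel₀ _ hΛ1.ne']; field_simp
      linear_combination (Λ * (Λ - 1)) * h1 - h2
    have h2 : 0 < α * (χ * (Λ * (Λ - 1))) := by rw [h]; linarith
    exact pos_of_mul_pos_left h2 (by positivity)
  -- The eigenvalues of `W`, which are the values of `α x + β x ^ 2` at `k (k + 1) / 2`.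
  set ev : Fin M → ℝ := fun k => α * (k * (k + 1) / 2) + β * (k * (k + 1) / 2) ^ 2 with hev
  have hev0 : ∀ k : Fin M, (k : ℕ) = 0 → ev k = 0 := by
    intro k hk
    simp [hev, hk]
  have hev1 : ∀ k : Fin M, (k : ℕ) = 1 → ev k = 1 / χ := by
    intro k hk
    simp only [hev, hk]
    rw [← hαβ]
    push_cast
    ring
  have hevM : ∀ k : Fin M, (k : ℕ) = M - 1 → ev k = 1 := by
    intro k hk
    have : ((k : ℕ) : ℝ) = M - 1 := by
      rw [hk]; push_cast [show 1 ≤ M by omega]; ring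
    simp only [hev, this]
    linear_combination hΛone
  have hχinv : 1 / χ ≤ 1 := by rw [div_le_one hχ0]; exact hχ
  have hχinv0 : 0 < 1 / χ := by positivity
  have hevpos : ∀ k : Fin M, (k : ℕ) ≠ 0 → 1 / χ ≤ ev k ∧ ev k ≤ 1 := by
    intro k hk
    rcases hMlow with h3 | hlow
    · -- For three vertices there are only two positive eigenvalues; `β` may be negative.
      have hk2 : (k : ℕ) = 1 ∨ (k : ℕ) = M - 1 := by have := k.isLt; omega
      rcases hk2 with h | h
      · rw [hev1 k h]; exact ⟨le_rfl, hχinv⟩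
      · rw [hevM k h]; exact ⟨hχinv, le_rfl⟩
    · have hβ0 : 0 ≤ β := by
        rw [hβ]
        apply div_nonneg _ hΛ1.le
        rw [sub_nonneg, div_le_one hχ0]
        exact hlow
      have hk1 : (1 : ℝ) ≤ (k : ℕ) := by exact_mod_cast Nat.one_le_iff_ne_zero.2 hk
      have hkM : ((k : ℕ) : ℝ) ≤ M - 1 := by
        have : (k : ℕ) + 1 ≤ M := k.isLt
        have : (((k : ℕ) + 1 : ℕ) : ℝ) ≤ M := by exact_mod_cast this
        push_cast at this
        linarith
      have hx1 : (1 : ℝ) ≤ k * (k + 1) / 2 := by nlinarith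
      have hx2 : (k * (k + 1) / 2 : ℝ) ≤ Λ := by rw [hΛ]; nlinarith
      simp only [hev]
      set x : ℝ := k * (k + 1) / 2
      constructor
      · rw [← hαβ]
        have : (1 : ℝ) ≤ x ^ 2 := by nlinarith
        nlinarith
      · rw [← hΛone]
        have : x ^ 2 ≤ Λ ^ 2 := by gcongr
        nlinarith
  set T := pathLaplacian M with hT
  set W : Matrix (Fin M) (Fin M) ℝ := α • T + β • (T * T) with hW
  have hspec : ∀ l, l ∈ spectrum ℝ W ↔ ∃ k, l = ev k := by
    intro l
    rw [spectrum.mem_iff, Matrix.isUnit_iff_isUnit_det, isUnit_iff_ne_zero, not_not]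
    have e : algebraMap ℝ (Matrix (Fin M) (Fin M) ℝ) l - W
        = l • (1 : Matrix (Fin M) (Fin M) ℝ) + (-α) • T + (-β) • (T * T) := by
      rw [Algebra.algebraMap_eq_smul_one, hW, neg_smul, neg_smul]
      abel
    rw [e, det_quadratic_pathLaplacian, Finset.prod_eq_zero_iff]
    constructor
    · rintro ⟨k, -, hk⟩
      exact ⟨k, by simp only [hev]; linarith⟩
    · rintro ⟨k, hk⟩
      exact ⟨k, Finset.mem_univ _, by rw [hk]; simp only [hev]; ring⟩
  have hTs : T.transpose = T := pathLaplacian_isSymm M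
  have hherm : W.IsHermitian := by
    rw [Matrix.IsHermitian, Matrix.conjTranspose_eq_transpose_of_trivial, hW,
      Matrix.transpose_add, Matrix.transpose_smul, Matrix.transpose_smul, Matrix.transpose_mul, hTs]
  have hpos : W.PosSemidef := by
    rw [hherm.posSemidef_iff_eigenvalues_nonneg]
    intro i
    obtain ⟨k, hk⟩ := (hspec _).1 (hherm.eigenvalues_mem_spectrum_real i)
    rw [Pi.zero_apply, hk]
    by_cases h : (k : ℕ) = 0
    · rw [hev0 k h]
    · exact hχinv0.le.trans (hevpos k h).1
  have hker : ∀ v : Fin M → ℝ, W.mulVec v = 0 ↔ ∃ a : ℝ, v = fun _ => a := by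
    intro v
    have hfac : W = (α • (1 : Matrix (Fin M) (Fin M) ℝ) + β • T + (0 : ℝ) • (T * T)) * T := by
      rw [zero_smul, add_zero, add_mul, Matrix.smul_mul, Matrix.smul_mul, Matrix.one_mul]
    rw [hfac, ← Matrix.mulVec_mulVec]
    constructor
    · intro h
      refine ⟨_, const_of_pathLaplacian_mulVec (by omega : 0 < M) ?_⟩
      refine Matrix.eq_zero_of_mulVec_eq_zero ?_ h
      rw [det_quadratic_pathLaplacian, Finset.prod_ne_zero_iff]
      intro k _ hk
      by_cases h0 : (k : ℕ) = 0
      · simp [h0] at hk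
        exact hα0.ne' hk
      · have h1 : ev k = 0 := by
          simp only [hev]
          linear_combination (k * (k + 1) / 2 : ℝ) * hk
        have := (hevpos k h0).1
        linarith
    · rintro ⟨a, rfl⟩
      rw [pathLaplacian_mulVec_const, Matrix.mulVec_zero]
  obtain ⟨G, hG⟩ := exists_isFixedNetwork (by omega) hpos hker (χ := χ)
    ⟨(hspec 1).2 ⟨⟨M - 1, by omega⟩, (hevM _ rfl).symm⟩, by
      intro l hl
      obtain ⟨k, rfl⟩ := (hspec l).1 hl
      by_cases h : (k : ℕ) = 0
      · rw [hev0 k h]; exact zero_le_one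
      · exact (hevpos k h).2⟩
    ⟨⟨(hspec _).2 ⟨⟨1, by omega⟩, (hev1 _ rfl).symm⟩, hχinv0⟩, by
      rintro l ⟨hl, hl0⟩
      obtain ⟨k, rfl⟩ := (hspec l).1 hl
      by_cases h : (k : ℕ) = 0
      · rw [hev0 k h] at hl0; exact absurd hl0 (lt_irrefl 0)
      · exact (hevpos k h).1⟩
  refine ⟨M, G, W, hM3, hG, ?_, ?_⟩
  · intro i j hij
    by_contra hlt
    refine (hG.support i j).2 (Or.inr hij) ?_
    have h1 : T i j = 0 := pathLaplacian_eq_zero_of_lt (Or.inr (by omega))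
    have h2 : (T * T) i j = 0 := by
      rw [Matrix.mul_apply]
      refine Finset.sum_eq_zero fun k _ => ?_
      by_cases hk : (k : ℕ) + 1 < i
      · rw [hT, pathLaplacian_eq_zero_of_lt (Or.inr hk), zero_mul]
      · rw [hT, pathLaplacian_eq_zero_of_lt (i := k) (j := j) (Or.inr (by omega)), mul_zero]
    simp [hW, h1, h2]
  · have h1 : M ≤ 3 * (M / 2) := by omega
    have h2 : (M : ℝ) ≤ 3 * (M / 2 : ℕ) := by exact_mod_cast h1
    nlinarith

/-! ### The hard problem -/

/-- The share of the chain that a worker holds: the first worker has the matching of the edges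
`{j, j + 1}` with `j` even, the last worker the one with `j` odd, and the others hold nothing. -/
noncomputable def chainShare (d : ℕ) (q : ℝ) {M : ℕ} (m : Fin M) : Rd d →ₗ[ℝ] Rd d :=
  if (m : ℕ) = 0 then chainRotation d q 0
  else if (m : ℕ) + 1 = M then chainRotation d q 1 else 0

/-- The hard instance. The strong monotonicity `μ` is distributed evenly, and the share of the chain
of each worker is carried by the component `0` alone. -/
noncomputable def chainProblem (d M n : ℕ) (μ β q : ℝ) : VIProblem d M n where
  comp m i z := (μ / M) • z + (if (i : ℕ) = 0 then (n * β) • chainShare d q m z else 0)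
    - (if (m : ℕ) = 0 then (μ + β * q) • firstVec d else 0)
  g := 0
  g_ne_bot := by simp
  g_proper := ⟨0, by simp⟩
  g_lsc := lowerSemicontinuous_const
  g_convex := by simp

lemma norm_chainShare_le {d M : ℕ} {q : ℝ} (hq0 : 0 ≤ q) (hq1 : q ≤ 1) (m : Fin M) (z : Rd d) :
    ‖chainShare d q m z‖ ≤ ‖z‖ := by
  unfold chainShare
  split_ifs
  · exact norm_chainRotation_le hq0 hq1 (by norm_num) z
  · exact norm_chainRotation_le hq0 hq1 (by norm_num) z
  · simp

lemma inner_chainShare_nonneg {d M : ℕ} {q : ℝ} (hq0 : 0 ≤ q) (m : Fin M) (z : Rd d) :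
    0 ≤ inner ℝ (chainShare d q m z) z := by
  unfold chainShare
  split_ifs
  · exact inner_chainRotation_nonneg hq0 (by norm_num) z
  · exact inner_chainRotation_nonneg hq0 (by norm_num) z
  · simp

lemma sum_chainShare {d M : ℕ} (hM : 2 ≤ M) (q : ℝ) (z : Rd d) :
    ∑ m : Fin M, chainShare d q m z = chainRotation d q 0 z + chainRotation d q 1 z := by
  have h : ∀ m : Fin M, chainShare d q m z
      = (if m = ⟨0, by omega⟩ then chainRotation d q 0 z else 0)
        + (if m = ⟨M - 1, by omega⟩ then chainRotation d q 1 z else 0) := by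
    intro m
    unfold chainShare
    simp only [Fin.ext_iff]
    by_cases h0 : (m : ℕ) = 0
    · rw [if_pos h0, if_pos h0, if_neg (by omega), add_zero]
    · by_cases h1 : (m : ℕ) + 1 = M
      · rw [if_neg h0, if_pos h1, if_neg h0, if_pos (by omega), zero_add]
      · rw [if_neg h0, if_neg h1, if_neg h0, if_neg (by omega), add_zero]
        rfl
  simp only [h, Finset.sum_add_distrib, Finset.sum_ite_eq', Finset.mem_univ, if_true]

section Problem

variable {d M n : ℕ} {μ β q : ℝ}

lemma chainProblem_comp_sub (m : Fin M) (i : Fin n) (u v : Rd d) :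
    (chainProblem d M n μ β q).comp m i u - (chainProblem d M n μ β q).comp m i v
      = (μ / M) • (u - v)
        + (if (i : ℕ) = 0 then (n * β) • chainShare d q m (u - v) else 0) := by
  simp only [chainProblem, map_sub, smul_sub]
  split_ifs <;> abel

lemma chainProblem_node (hn : 0 < n) (m : Fin M) (z : Rd d) :
    (chainProblem d M n μ β q).node m z = (μ / M) • z + β • chainShare d q m z
      - (if (m : ℕ) = 0 then (μ + β * q) • firstVec d else 0) := by
  have hn' : (n : ℝ) ≠ 0 := by exact_mod_cast hn.ne'
  have h0 : ∑ i : Fin n, (if (i : ℕ) = 0 then (n * β) • chainShare d q m z else 0)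
      = (n * β) • chainShare d q m z := by
    rw [Finset.sum_eq_single ⟨0, hn⟩]
    · simp
    · intro i _ hi
      rw [if_neg fun h => hi (Fin.ext h)]
    · simp
  simp only [VIProblem.node, chainProblem, Finset.sum_sub_distrib, Finset.sum_add_distrib, h0,
    Finset.sum_const, Finset.card_univ, Fintype.card_fin, smul_sub, smul_add]
  simp only [← Nat.cast_smul_eq_nsmul ℝ, smul_smul, ← mul_assoc, one_div, inv_mul_cancel₀ hn',
    one_mul, one_smul]

lemma chainProblem_node_sub (hn : 0 < n) (m : Fin M) (u v : Rd d) :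
    (chainProblem d M n μ β q).node m u - (chainProblem d M n μ β q).node m v
      = (μ / M) • (u - v) + β • chainShare d q m (u - v) := by
  simp only [chainProblem_node hn, map_sub, smul_sub]
  abel

lemma chainProblem_total (hn : 0 < n) (hM : 2 ≤ M) (z : Rd d) :
    (chainProblem d M n μ β q).total z
      = μ • z + β • (chainRotation d q 0 z + chainRotation d q 1 z)
        - (μ + β * q) • firstVec d := by
  have hM' : (M : ℝ) ≠ 0 := by
    have : M ≠ 0 := by omega
    exact_mod_cast this
  have h0 : ∑ m : Fin M, (if (m : ℕ) = 0 then (μ + β * q) • firstVec d else 0)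
      = (μ + β * q) • firstVec d := by
    rw [Finset.sum_eq_single ⟨0, by omega⟩]
    · simp
    · intro i _ hi
      rw [if_neg fun h => hi (Fin.ext h)]
    · simp
  simp only [VIProblem.total, chainProblem_node hn, Finset.sum_sub_distrib, Finset.sum_add_distrib,
    h0, ← Finset.smul_sum, sum_chainShare hM, Finset.sum_const, Finset.card_univ, Fintype.card_fin]
  rw [← Nat.cast_smul_eq_nsmul ℝ, smul_smul, div_mul_cancel₀ _ hM']

lemma chainProblem_node_stronglyMonotone (hn : 0 < n) (hβ : 0 ≤ β) (hq0 : 0 ≤ q) (m : Fin M) :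
    IsStronglyMonotone (μ / M) ((chainProblem d M n μ β q).node m) := by
  intro u v
  rw [chainProblem_node_sub hn, inner_add_left, real_inner_smul_left, real_inner_smul_left,
    real_inner_self_eq_norm_sq]
  have := mul_nonneg hβ (inner_chainShare_nonneg hq0 m (u - v))
  linarith

lemma chainProblem_total_stronglyMonotone (hn : 0 < n) (hM : 2 ≤ M) (hβ : 0 ≤ β) (hq0 : 0 ≤ q) :
    IsStronglyMonotone μ (chainProblem d M n μ β q).total := by
  intro u v
  have h : (chainProblem d M n μ β q).total u - (chainProblem d M n μ β q).total v
      = μ • (u - v) + β • (chainRotation d q 0 (u - v) + chainRotation d q 1 (u - v)) := by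
    simp only [chainProblem_total hn hM, map_sub, smul_sub, smul_add]
    abel
  rw [h, inner_add_left, real_inner_smul_left, real_inner_smul_left, inner_add_left,
    real_inner_self_eq_norm_sq]
  have := mul_nonneg hβ (add_nonneg (inner_chainRotation_nonneg hq0 (p := 0) (by norm_num) (u - v))
    (inner_chainRotation_nonneg hq0 (p := 1) (by norm_num) (u - v)))
  linarith

lemma chainProblem_node_lipschitz {L : ℝ} (hn : 0 < n) (hM : 2 ≤ M) (hμ : 0 < μ) (hμL : μ ≤ L)
    (hq0 : 0 ≤ q) (hq1 : q ≤ 1) (m : Fin M) :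
    IsLipschitzOp L ((chainProblem d M n μ (L / 2) q).node m) := by
  intro u v
  have hM' : (2 : ℝ) ≤ M := by exact_mod_cast hM
  have hL0 : 0 ≤ L := hμ.le.trans hμL
  have h1 : μ / M ≤ L / 2 := by gcongr
  have h0 : 0 ≤ μ / M := by positivity
  rw [chainProblem_node_sub hn]
  calc ‖(μ / M) • (u - v) + (L / 2) • chainShare d q m (u - v)‖
      ≤ ‖(μ / M) • (u - v)‖ + ‖(L / 2) • chainShare d q m (u - v)‖ := norm_add_le _ _
    _ ≤ L / 2 * ‖u - v‖ + L / 2 * ‖u - v‖ := by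
        rw [norm_smul, norm_smul, Real.norm_of_nonneg h0, Real.norm_of_nonneg (h0.trans h1)]
        have := norm_chainShare_le hq0 hq1 m (u - v)
        gcongr
    _ = L * ‖u - v‖ := by ring

/-- Concentrating the share of the chain in one of the `n` components, with the factor `n` that the
average requires, costs a factor `√n` in the average Lipschitz constant. -/
lemma chainProblem_averageLipschitz {L Lbar : ℝ} (hn : 0 < n) (hM : 2 ≤ M) (hμ : 0 < μ)
    (hμL : μ ≤ L) (hL : Lbar ^ 2 = n * L ^ 2) (hq0 : 0 ≤ q) (hq1 : q ≤ 1) (m : Fin M) :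
    IsAverageLipschitz Lbar ((chainProblem d M n μ (L / 2) q).comp m) := by
  intro u v
  have hn1 : (1 : ℝ) ≤ n := by exact_mod_cast hn
  have hM' : (2 : ℝ) ≤ M := by exact_mod_cast hM
  have hL0 : 0 ≤ L := hμ.le.trans hμL
  have h1 : μ / M ≤ L / 2 := by gcongr
  have h0 : 0 ≤ μ / M := by positivity
  set w := u - v
  have hterm : ∀ i : Fin n, ‖(chainProblem d M n μ (L / 2) q).comp m i u
        - (chainProblem d M n μ (L / 2) q).comp m i v‖ ^ 2
      ≤ L ^ 2 / 2 * ‖w‖ ^ 2 + (if (i : ℕ) = 0 then n ^ 2 * L ^ 2 / 2 * ‖w‖ ^ 2 else 0) := by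
    intro i
    rw [chainProblem_comp_sub]
    have e1 : ‖(μ / M) • w‖ ≤ L / 2 * ‖w‖ := by
      rw [norm_smul, Real.norm_of_nonneg h0]
      gcongr
    have e1' : ‖(μ / M) • w‖ ^ 2 ≤ L ^ 2 / 4 * ‖w‖ ^ 2 :=
      (pow_le_pow_left₀ (norm_nonneg _) e1 2).trans_eq (by ring)
    split_ifs
    · have e2 : ‖(n * (L / 2)) • chainShare d q m w‖ ≤ n * (L / 2) * ‖w‖ := by
        have : (0 : ℝ) ≤ n * (L / 2) := mul_nonneg (by linarith) (h0.trans h1)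
        rw [norm_smul, Real.norm_of_nonneg this]
        gcongr
        exact norm_chainShare_le hq0 hq1 m _
      have e2' : ‖(n * (L / 2)) • chainShare d q m w‖ ^ 2 ≤ n ^ 2 * L ^ 2 / 4 * ‖w‖ ^ 2 :=
        (pow_le_pow_left₀ (norm_nonneg _) e2 2).trans_eq (by ring)
      have e3 : ‖(μ / M) • w + (n * (L / 2)) • chainShare d q m w‖ ^ 2
          ≤ (‖(μ / M) • w‖ + ‖(n * (L / 2)) • chainShare d q m w‖) ^ 2 :=
        pow_le_pow_left₀ (norm_nonneg _) (norm_add_le _ _) 2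
      nlinarith [add_sq_le (a := ‖(μ / M) • w‖) (b := ‖(n * (L / 2)) • chainShare d q m w‖)]
    · rw [add_zero, add_zero]
      refine e1'.trans ?_
      gcongr
      norm_num
  have hsum : ∑ i : Fin n, (if (i : ℕ) = 0 then n ^ 2 * L ^ 2 / 2 * ‖w‖ ^ 2 else 0)
      = n ^ 2 * L ^ 2 / 2 * ‖w‖ ^ 2 := by
    rw [Finset.sum_eq_single ⟨0, hn⟩]
    · simp
    · intro i _ hi
      rw [if_neg fun h => hi (Fin.ext h)]
    · simp
  calc (1 / (n : ℝ)) * ∑ i, ‖(chainProblem d M n μ (L / 2) q).comp m i u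
        - (chainProblem d M n μ (L / 2) q).comp m i v‖ ^ 2
      ≤ (1 / (n : ℝ)) * ∑ i : Fin n, (L ^ 2 / 2 * ‖w‖ ^ 2
          + (if (i : ℕ) = 0 then n ^ 2 * L ^ 2 / 2 * ‖w‖ ^ 2 else 0)) := by
        gcongr with i
        exact hterm i
    _ = (1 + n) / 2 * (L ^ 2 * ‖w‖ ^ 2) := by
        rw [Finset.sum_add_distrib, hsum, Finset.sum_const, Finset.card_univ, Fintype.card_fin,
          nsmul_eq_mul]
        field_simp
    _ ≤ n * (L ^ 2 * ‖w‖ ^ 2) := by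
        gcongr
        linarith
    _ = Lbar ^ 2 * ‖w‖ ^ 2 := by rw [hL]; ring

lemma chainProblem_isSolution (hn : 0 < n) (hM : 2 ≤ M) (h : β * q ^ 2 + μ * q = β) :
    (chainProblem d M n μ β q).IsSolution (geomVec d q) := by
  refine ⟨by simp [chainProblem], fun y => ?_⟩
  rw [chainProblem_total hn hM, chain_equation h]
  simp [chainProblem]

/-! ### Growth of the memories -/

lemma IsProx.eq_of_zero {ρ : ℝ} {w p : Rd d} (h : IsProx (0 : Rd d → EReal) ρ w p) : p = w := by
  have h1 := h w
  simp only [Pi.zero_apply, mul_zero, zero_add, sub_self, norm_zero, EReal.coe_le_coe_iff] at h1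
  have h2 : ‖p - w‖ ^ 2 ≤ 0 := by linarith
  have h3 : ‖p - w‖ = 0 := by
    have := sq_nonneg ‖p - w‖
    exact pow_eq_zero_iff (two_ne_zero) |>.1 (le_antisymm h2 this)
  exact sub_eq_zero.1 (norm_eq_zero.1 h3)

/-- A subspace that is invariant under the batch operator confines the memory. -/
lemma LocalUpdate.subset {H : Rd d → Rd d} {A A' : Set (Rd d)} {V : Submodule ℝ (Rd d)}
    (hH : ∀ z ∈ V, H z ∈ V) (h : LocalUpdate (0 : Rd d → EReal) H A A') (hA : A ⊆ V) :
    A' ⊆ V := by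
  induction h with
  | refl => exact hA
  | tail _ hstep ih =>
    obtain ⟨z, ⟨z₁, h1, z₂, h2, z₃, h3, ρ, _, hz⟩, rfl⟩ := hstep
    refine Set.insert_subset ?_ ih
    refine Submodule.span_le.2 ?_ hz
    rintro x ((rfl | rfl) | ⟨w, hw, hx⟩)
    · exact ih h1
    · exact hH _ (ih h2)
    · rw [hx.eq_of_zero]
      refine Submodule.span_le.2 ?_ hw
      rintro y (rfl | rfl)
      · exact ih h3
      · exact hH _ (ih h2)

lemma chainProblem_batchSum_mem {V : Submodule ℝ (Rd d)} (he : firstVec d ∈ V) {m : Fin M}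
    {S : Finset (Fin n)} {z : Rd d} (hz : z ∈ V)
    (h : (∃ i ∈ S, (i : ℕ) = 0) → chainShare d q m z ∈ V) :
    (chainProblem d M n μ β q).batchSum m S z ∈ V := by
  refine V.sum_mem fun i hi => V.sub_mem (V.add_mem (V.smul_mem _ hz) ?_) ?_
  · split_ifs with h0
    · exact V.smul_mem _ (h ⟨i, hi, h0⟩)
    · exact V.zero_mem
  · split_ifs
    · exact V.smul_mem _ he
    · exact V.zero_mem

lemma chainShare_mem {k : ℕ} {m : Fin M} {z : Rd d} (hz : z ∈ headSubspace d k)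
    (h0 : (m : ℕ) = 0 → k % 2 = 0) (h1 : (m : ℕ) ≠ 0 → (m : ℕ) + 1 = M → k % 2 = 1) :
    chainShare d q m z ∈ headSubspace d k := by
  unfold chainShare
  split_ifs with h h'
  · exact chainRotation_mem (h0 h) hz
  · exact chainRotation_mem (h1 h h') hz
  · exact Submodule.zero_mem _

end Problem

namespace Procedure

variable {d M n K N : ℕ} {P : VIProblem d M n} {G : SimpleGraph (Fin M)} {Ω : Type u}
  [MeasurableSpace Ω] {ℙ : Measure Ω}

open Classical in
/-- The number of communication rounds before iteration `t`. -/
noncomputable def rounds (A : Procedure P G K N Ω ℙ) (ω : Ω) (t : ℕ) : ℕ :=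
  Nat.count (fun s => ω ∈ A.comm s) t

open Classical in
/-- The number of batches before iteration `t`, drawn by the first or the last worker, that contain
the component `0`. -/
noncomputable def hits (A : Procedure P G K N Ω ℙ) (t : ℕ) (ω : Ω) : ℕ :=
  ∑ s ∈ Finset.range t, ∑ m : Fin M,
    if ((m : ℕ) = 0 ∨ (m : ℕ) + 1 = M) ∧ ∃ i ∈ A.batch s m ω, (i : ℕ) = 0 then 1 else 0

lemma rounds_le (A : Procedure P G K N Ω ℙ) (ω : Ω) : A.rounds ω A.T ≤ K := by
  classical
  refine le_trans (le_of_eq ?_) (A.comm_budget ω)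
  rw [rounds, Nat.count_eq_card_filter_range, ← Set.ncard_coe_finset]
  congr 1
  ext t
  simp

/-- Before iteration `t`, the coordinate `k` has reached the worker `m` only if
`(k - 1) (M / 2)` communication rounds have carried the earlier coordinates to and fro between the
ends of the network, and further rounds have brought it to `m`. -/
lemma mem_subset_of_rounds {μ β q : ℝ} (hM : 3 ≤ M)
    (hG : ∀ i j : Fin M, G.Adj i j → (i : ℕ) ≤ j + 2)
    (A : Procedure (chainProblem d M n μ β q) G K N Ω ℙ) (ω : Ω) (t : ℕ) (ht : t ≤ A.T) :
    ∀ (k : ℕ) (m : Fin M), 1 ≤ k →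
      A.rounds ω t < (k - 1) * (M / 2) + (if k % 2 = 1 then ((m : ℕ) + 1) / 2 else (M - m) / 2) →
      A.mem t m ω ⊆ headSubspace d k := by
  classical
  induction t with
  | zero =>
    intro k m _ _
    rw [A.mem_zero]
    simp
  | succ t ih =>
    have ih := ih (by omega)
    intro k m hk hlt
    have hm := m.isLt
    by_cases hc : ω ∈ A.comm t
    · rw [A.mem_comm t (by omega) ω hc m]
      have hr : A.rounds ω (t + 1) = A.rounds ω t + 1 := by
        simp [rounds, Nat.count_succ, hc]
      refine Submodule.span_le.2 (Set.iUnion₂_subset fun i hi => ih k i hk ?_)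
      rw [hr] at hlt
      have h12 : (m : ℕ) ≤ i + 2 ∧ (i : ℕ) ≤ m + 2 := by
        rcases hi with rfl | hi
        · omega
        · exact ⟨hG _ _ hi.symm, hG _ _ hi⟩
      have hi := i.isLt
      split_ifs at hlt ⊢ with hp <;> omega
    · have hr : A.rounds ω (t + 1) = A.rounds ω t := by
        simp [rounds, Nat.count_succ, hc]
      rw [hr] at hlt
      by_cases hinv : ((m : ℕ) = 0 → k % 2 = 0) ∧ ((m : ℕ) ≠ 0 → (m : ℕ) + 1 = M → k % 2 = 1)
      · refine (A.mem_local t (by omega) ω hc m).subset (fun z hz => ?_) (ih k m hk hlt)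
        exact chainProblem_batchSum_mem (firstVec_mem hk) hz fun _ => chainShare_mem hz hinv.1 hinv.2
      · -- The worker can extend the chain; then it does not yet have the coordinate `k - 1`.
        have hd : (if k % 2 = 1 then ((m : ℕ) + 1) / 2 else (M - m) / 2) = 0 := by
          split_ifs with hp <;> omega
        rw [hd, add_zero] at hlt
        have hk2 : 2 ≤ k := by
          by_contra h
          have : k = 1 := by omega
          simp [this] at hlt
        obtain ⟨l, rfl⟩ : ∃ l, k = l + 2 := ⟨k - 2, by omega⟩
        have hlt' : A.rounds ω t < (l + 1 - 1) * (M / 2)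
            + (if (l + 1) % 2 = 1 then ((m : ℕ) + 1) / 2 else (M - m) / 2) := by
          have e : (l + 2 - 1) * (M / 2) = l * (M / 2) + M / 2 := by
            rw [show l + 2 - 1 = l + 1 by omega]; ring
          rw [e] at hlt
          rw [Nat.add_sub_cancel]
          split_ifs with hp <;> omega
        refine Set.Subset.trans ?_ (headSubspace_mono (show l + 1 ≤ l + 2 by omega))
        refine (A.mem_local t (by omega) ω hc m).subset (fun z hz => ?_) (ih (l + 1) m (by omega) hlt')
        refine chainProblem_batchSum_mem (firstVec_mem (by omega)) hz fun _ =>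
          chainShare_mem hz ?_ ?_ <;> omega

lemma out_mem_of_rounds {μ β q : ℝ} (hM : 3 ≤ M)
    (hG : ∀ i j : Fin M, G.Adj i j → (i : ℕ) ≤ j + 2)
    (A : Procedure (chainProblem d M n μ β q) G K N Ω ℙ) (ω : Ω) :
    A.out ω ∈ headSubspace d (K / (M / 2) + 2) := by
  refine Submodule.span_le.2 (Set.iUnion_subset fun m => ?_) (A.out_mem ω)
  refine mem_subset_of_rounds hM hG A ω A.T le_rfl _ m (Nat.le_add_left 1 _) ?_
  refine (A.rounds_le ω).trans_lt (Nat.lt_add_right _ ?_)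
  rw [Nat.add_sub_assoc one_le_two, mul_comm]
  exact Nat.lt_mul_div_succ K (by omega)

/-- Every batch with the component `0` at an end of the network extends the chain by at most one
coordinate, because the next edge belongs to the other end. -/
lemma mem_subset_of_hits {μ β q : ℝ} (hM : 2 ≤ M)
    (A : Procedure (chainProblem d M n μ β q) G K N Ω ℙ) (ω : Ω) (t : ℕ) (ht : t ≤ A.T) :
    ∀ m : Fin M, A.mem t m ω ⊆ headSubspace d (A.hits t ω + 1) := by
  classical
  induction t with
  | zero =>
    intro m
    rw [A.mem_zero]
    simp
  | succ t ih =>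
    have ih := ih (by omega)
    intro m
    have hle : A.hits t ω ≤ A.hits (t + 1) ω := by
      rw [hits, hits, Finset.sum_range_succ]
      exact Nat.le_add_right _ _
    by_cases hc : ω ∈ A.comm t
    · rw [A.mem_comm t (by omega) ω hc m]
      exact Submodule.span_le.2 (Set.iUnion₂_subset fun i _ =>
        (ih i).trans (headSubspace_mono (by omega)))
    · set k := A.hits t ω + 1 with hk
      by_cases hinv : (∃ i ∈ A.batch t m ω, (i : ℕ) = 0) →
          ((m : ℕ) = 0 → k % 2 = 0) ∧ ((m : ℕ) ≠ 0 → (m : ℕ) + 1 = M → k % 2 = 1)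
      · refine Set.Subset.trans ?_ (headSubspace_mono (show k ≤ _ by omega))
        refine (A.mem_local t (by omega) ω hc m).subset (fun z hz => ?_) (ih m)
        exact chainProblem_batchSum_mem (firstVec_mem (by omega)) hz fun h =>
          chainShare_mem hz (hinv h).1 (hinv h).2
      · obtain ⟨hi, hpar⟩ := Classical.not_imp.1 hinv
        have hend : (m : ℕ) = 0 ∨ (m : ℕ) + 1 = M := by omega
        have hlt : A.hits t ω + 1 ≤ A.hits (t + 1) ω := by
          rw [hits, hits, Finset.sum_range_succ]
          refine Nat.add_le_add_left ?_ _
          refine le_trans ?_ (Finset.single_le_sum (fun _ _ => Nat.zero_le _) (Finset.mem_univ m))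
          rw [if_pos ⟨hend, hi⟩]
        refine Set.Subset.trans ?_ (headSubspace_mono (show k + 1 ≤ _ by omega))
        refine (A.mem_local t (by omega) ω hc m).subset (fun z hz => ?_)
          ((ih m).trans (headSubspace_mono (by omega)))
        refine chainProblem_batchSum_mem (firstVec_mem (by omega)) hz fun _ =>
          chainShare_mem hz ?_ ?_ <;> omega

lemma out_mem_of_hits {μ β q : ℝ} (hM : 2 ≤ M)
    (A : Procedure (chainProblem d M n μ β q) G K N Ω ℙ) (ω : Ω) :
    A.out ω ∈ headSubspace d (A.hits A.T ω + 1) :=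
  Submodule.span_le.2 (Set.iUnion_subset fun m => mem_subset_of_hits hM A ω A.T le_rfl m)
    (A.out_mem ω)

/-! ### The expected number of useful batches -/

lemma measurableSet_batch (A : Procedure P G K N Ω ℙ) (t : ℕ) (m : Fin M) (s : Finset (Fin n)) :
    MeasurableSet {ω | A.batch t m ω = s} :=
  A.ℱ.le (t + 1) _ (A.batch_meas t m s)

lemma measurableSet_batches (A : Procedure P G K N Ω ℙ) (t : ℕ) (s : Fin M → Finset (Fin n)) :
    MeasurableSet ((fun ω m => A.batch t m ω) ⁻¹' {s}) := by
  have : (fun ω m => A.batch t m ω) ⁻¹' {s} = ⋂ m, {ω | A.batch t m ω = s m} := by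
    ext ω
    simp [funext_iff]
  rw [this]
  exact MeasurableSet.iInter fun m => A.measurableSet_batch t m (s m)

lemma measurableSet_mem_batch (A : Procedure P G K N Ω ℙ) (t : ℕ) (m : Fin M) (i : Fin n) :
    MeasurableSet {ω | i ∈ A.batch t m ω} := by
  have : {ω | i ∈ A.batch t m ω} = ⋃ s ∈ {s : Finset (Fin n) | i ∈ s}, {ω | A.batch t m ω = s} := by
    ext ω
    simp
  rw [this]
  exact MeasurableSet.biUnion (Set.to_countable _) fun s _ => A.measurableSet_batch t m s

/-- The probability of a tuple of batches depends only on their sizes. -/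
lemma measure_batches_eq (A : Procedure P G K N Ω ℙ) {t : ℕ} (ht : t < A.T)
    {s s' : Fin M → Finset (Fin n)} (h : ∀ m, (s m).card = (s' m).card) :
    ℙ ((fun ω m => A.batch t m ω) ⁻¹' {s}) = ℙ ((fun ω m => A.batch t m ω) ⁻¹' {s'}) := by
  set E : Set Ω := ⋂ m, {ω | A.size t m ω = (s m).card} with hE
  have hEm : MeasurableSet[A.ℱ t] E :=
    MeasurableSet.iInter fun m => A.size_meas t m _
  have key : ∀ r : Fin M → Finset (Fin n), (∀ m, (s m).card = (r m).card) →
      ℙ ((fun ω m => A.batch t m ω) ⁻¹' {r}) * ∏ m, ((n.choose (s m).card : ℕ) : ℝ≥0∞) = ℙ E := by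
    intro r hr
    have h1 := A.batch_uniform t ht E hEm r fun ω hω m => by
      rw [← hr m]
      exact Set.mem_iInter.1 hω m
    have h2 : E ∩ {ω | ∀ m, A.batch t m ω = r m} = (fun ω m => A.batch t m ω) ⁻¹' {r} := by
      ext ω
      simp only [hE, Set.mem_inter_iff, Set.mem_iInter, Set.mem_ofPred_eq, Set.mem_preimage,
        Set.mem_singleton_iff, funext_iff, and_iff_right_iff_imp]
      intro h m
      rw [hr m, ← h m, A.batch_card]
    rw [h2] at h1
    simpa only [hr] using h1
  have h0 : ∏ m, ((n.choose (s m).card : ℕ) : ℝ≥0∞) ≠ 0 := by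
    refine Finset.prod_ne_zero_iff.2 fun m _ => ?_
    have := Nat.choose_pos (card_finset_fin_le (s m))
    exact_mod_cast this.ne'
  have htop : ∏ m, ((n.choose (s m).card : ℕ) : ℝ≥0∞) ≠ ∞ :=
    ENNReal.prod_ne_top fun m _ => ENNReal.natCast_ne_top _
  exact (ENNReal.mul_left_inj h0 htop).1 ((key s fun _ => rfl).trans (key s' h).symm)

lemma measure_mem_batch_eq_sum (A : Procedure P G K N Ω ℙ) (t : ℕ) (m : Fin M) (i : Fin n) :
    ℙ {ω | i ∈ A.batch t m ω} = ∑ s : Fin M → Finset (Fin n),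
      if i ∈ s m then ℙ ((fun ω m => A.batch t m ω) ⁻¹' {s}) else 0 := by
  rw [← Finset.sum_filter, sum_measure_preimage_singleton _ fun s _ => A.measurableSet_batches t s]
  congr 1
  ext ω
  simp

/-- All components are equally likely to be drawn. -/
lemma measure_mem_batch_eq (A : Procedure P G K N Ω ℙ) {t : ℕ} (ht : t < A.T) (m : Fin M)
    (i j : Fin n) : ℙ {ω | i ∈ A.batch t m ω} = ℙ {ω | j ∈ A.batch t m ω} := by
  rw [measure_mem_batch_eq_sum, measure_mem_batch_eq_sum]
  -- Exchanging `i` and `j` in all batches preserves their sizes.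
  let e : (Fin M → Finset (Fin n)) ≃ (Fin M → Finset (Fin n)) :=
    Equiv.piCongrRight fun _ => (Equiv.swap i j).finsetCongr
  rw [← Equiv.sum_comp e]
  refine Finset.sum_congr rfl fun s _ => ?_
  have h1 : i ∈ e s m ↔ j ∈ s m := by
    simp [e]
  have h2 : ∀ m, (e s m).card = (s m).card := by
    intro m
    simp [e]
  simp only [h1, A.measure_batches_eq ht h2]

lemma natCast_mul_measure_mem_batch (A : Procedure P G K N Ω ℙ) {t : ℕ} (ht : t < A.T) (m : Fin M)
    (i : Fin n) : n * ℙ {ω | i ∈ A.batch t m ω} = ∫⁻ ω, (A.size t m ω : ℝ≥0∞) ∂ℙ := by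
  classical
  have h1 : ∀ ω, (A.size t m ω : ℝ≥0∞)
      = ∑ j : Fin n, {ω | j ∈ A.batch t m ω}.indicator (fun _ => (1 : ℝ≥0∞)) ω := by
    intro ω
    rw [← A.batch_card t m ω]
    simp [Set.indicator_apply]
  simp only [h1]
  rw [lintegral_finsetSum _ fun j _ =>
    (measurable_const.indicator (A.measurableSet_mem_batch t m j))]
  simp only [lintegral_indicator_const (A.measurableSet_mem_batch t m _), one_mul,
    A.measure_mem_batch_eq ht m _ i]
  simp

lemma lintegral_size_le [IsProbabilityMeasure ℙ] (A : Procedure P G K N Ω ℙ) (m : Fin M) :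
    ∑ t ∈ Finset.range A.T, ∫⁻ ω, (A.size t m ω : ℝ≥0∞) ∂ℙ ≤ N := by
  have hmeas : ∀ t, Measurable fun ω => (A.size t m ω : ℝ≥0∞) := by
    intro t
    have : Measurable fun ω => A.size t m ω :=
      measurable_to_countable' fun b => A.ℱ.le t _ (A.size_meas t m b)
    exact (measurable_from_top (f := fun x : ℕ => (x : ℝ≥0∞))).comp this
  rw [← lintegral_finsetSum _ fun t _ => hmeas t]
  calc ∫⁻ ω, ∑ t ∈ Finset.range A.T, (A.size t m ω : ℝ≥0∞) ∂ℙ ≤ ∫⁻ _, (N : ℝ≥0∞) ∂ℙ := by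
        refine lintegral_mono fun ω => ?_
        rw [← Nat.cast_sum]
        exact Nat.cast_le.2 (A.local_budget m ω)
    _ = N := by simp

open Classical in
lemma hits_eq_indicator (hn : 0 < n) (A : Procedure P G K N Ω ℙ) (t : ℕ) (ω : Ω) :
    (A.hits t ω : ℝ≥0∞) = ∑ s ∈ Finset.range t,
      ∑ m ∈ Finset.univ.filter (fun m : Fin M => (m : ℕ) = 0 ∨ (m : ℕ) + 1 = M),
        {ω | (⟨0, hn⟩ : Fin n) ∈ A.batch s m ω}.indicator (fun _ => (1 : ℝ≥0∞)) ω := by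
  have h : ∀ s m, (∃ i ∈ A.batch s m ω, (i : ℕ) = 0) ↔ (⟨0, hn⟩ : Fin n) ∈ A.batch s m ω := by
    intro s m
    constructor
    · rintro ⟨i, hi, h0⟩
      have : i = ⟨0, hn⟩ := Fin.ext h0
      rwa [← this]
    · exact fun h => ⟨_, h, rfl⟩
  simp only [hits, h, ite_and, Nat.cast_sum, Finset.sum_filter, Set.indicator_apply,
    Set.mem_ofPred_eq]
  push_cast
  rfl

lemma measurable_hits (hn : 0 < n) (A : Procedure P G K N Ω ℙ) (t : ℕ) :
    Measurable fun ω => (A.hits t ω : ℝ≥0∞) := by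
  simp only [A.hits_eq_indicator hn]
  exact Finset.measurable_sum _ fun s _ => Finset.measurable_sum _ fun m _ =>
    measurable_const.indicator (A.measurableSet_mem_batch s m _)

/-- Each unit of local work at an end of the network hits the component `0` with probability
`1 / n`. -/
lemma natCast_mul_lintegral_hits_le [IsProbabilityMeasure ℙ] (hn : 0 < n)
    (A : Procedure P G K N Ω ℙ) :
    n * ∫⁻ ω, (A.hits A.T ω : ℝ≥0∞) ∂ℙ ≤ 2 * N := by
  classical
  simp only [A.hits_eq_indicator hn]
  have hmeas : ∀ s (m : Fin M), Measurable
      ({ω | (⟨0, hn⟩ : Fin n) ∈ A.batch s m ω}.indicator (fun _ => (1 : ℝ≥0∞))) := fun s m =>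
    measurable_const.indicator (A.measurableSet_mem_batch s m _)
  rw [lintegral_finsetSum _ fun s _ => Finset.measurable_sum _ fun m _ => hmeas s m]
  simp only [lintegral_finsetSum _ fun m _ => hmeas _ m,
    lintegral_indicator_const (A.measurableSet_mem_batch _ _ _), one_mul, Finset.mul_sum]
  rw [Finset.sum_comm]
  have hcard : (Finset.univ.filter (fun m : Fin M => (m : ℕ) = 0 ∨ (m : ℕ) + 1 = M)).card ≤ 2 := by
    have : (Finset.univ.filter (fun m : Fin M => (m : ℕ) = 0 ∨ (m : ℕ) + 1 = M)).map
        Fin.valEmbedding ⊆ {0, M - 1} := by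
      intro x hx
      simp only [Finset.mem_map, Finset.mem_filter, Finset.mem_univ, true_and,
        Fin.valEmbedding_apply] at hx
      obtain ⟨m, hm, rfl⟩ := hx
      simp only [Finset.mem_insert, Finset.mem_singleton]
      omega
    rw [← Finset.card_map Fin.valEmbedding]
    exact (Finset.card_le_card this).trans Finset.card_le_two
  refine (Finset.sum_le_card_nsmul _ _ (N : ℝ≥0∞) fun m _ => ?_).trans ?_
  · refine le_trans (le_of_eq ?_) (A.lintegral_size_le m)
    exact Finset.sum_congr rfl fun t ht =>
      A.natCast_mul_measure_mem_batch (Finset.mem_range.1 ht) m _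
  · rw [nsmul_eq_mul]
    gcongr
    exact_mod_cast hcard

end Procedure

/-! ### The two lower bounds -/

lemma ofReal_le_lintegral_of_le {Ω : Type u} [MeasurableSpace Ω] {ℙ : Measure Ω}
    [IsProbabilityMeasure ℙ] {X : Ω → ℝ} {a : ℝ} (h : ∀ ω, a ≤ X ω) :
    ENNReal.ofReal a ≤ ∫⁻ ω, ENNReal.ofReal (X ω) ∂ℙ := by
  calc ENNReal.ofReal a = ∫⁻ _, ENNReal.ofReal a ∂ℙ := by simp
    _ ≤ _ := lintegral_mono fun ω => ENNReal.ofReal_le_ofReal (h ω)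

/-- Jensen's inequality for `x ↦ exp (-x)`, in the form of its tangent line at the bound `b` for the
expectation of `H`. -/
lemma ofReal_exp_le_lintegral {Ω : Type u} [MeasurableSpace Ω] {ℙ : Measure Ω}
    [IsProbabilityMeasure ℙ] {X : Ω → ℝ} {H : Ω → ℕ} {a b r R : ℝ} (ha : 0 ≤ a) (hb : 0 ≤ b)
    (hR : 0 ≤ R) (hHm : Measurable fun ω => (H ω : ℝ≥0∞))
    (hH : ∫⁻ ω, (H ω : ℝ≥0∞) ∂ℙ ≤ ENNReal.ofReal b)
    (hX : ∀ ω, (Real.exp (-(a * (H ω + 1))) - r) * R ≤ X ω) :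
    ENNReal.ofReal ((Real.exp (-(a * (b + 1))) - r) * R)
      ≤ ∫⁻ ω, ENNReal.ofReal (X ω) ∂ℙ := by
  set E := Real.exp (-(a * (b + 1)))
  have hE : 0 < E := Real.exp_pos _
  set s := a * E * R
  have hs : 0 ≤ s := by positivity
  rcases le_or_gt ((E - r) * R) 0 with hneg | hpos
  · rw [ENNReal.ofReal_of_nonpos hneg]
    exact zero_le
  have hpt : ∀ ω, ENNReal.ofReal ((E - r) * R + s * b)
      ≤ ENNReal.ofReal (X ω) + ENNReal.ofReal s * (H ω : ℝ≥0∞) := by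
    intro ω
    have h1 : E * (1 + a * (b - H ω)) ≤ Real.exp (-(a * (H ω + 1))) := by
      have e : Real.exp (-(a * (H ω + 1))) = E * Real.exp (a * (b - H ω)) := by
        rw [← Real.exp_add]
        congr 1
        ring
      rw [e]
      gcongr
      linarith [Real.add_one_le_exp (a * (b - H ω))]
    have h2 : (E - r) * R + s * b ≤ X ω + s * H ω := by
      have := mul_le_mul_of_nonneg_right h1 hR
      have hx := hX ω
      simp only [s]
      nlinarith
    calc ENNReal.ofReal ((E - r) * R + s * b) ≤ ENNReal.ofReal (X ω + s * H ω) :=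
          ENNReal.ofReal_le_ofReal h2
      _ ≤ ENNReal.ofReal (X ω) + ENNReal.ofReal (s * H ω) := ENNReal.ofReal_add_le
      _ = _ := by rw [ENNReal.ofReal_mul hs, ENNReal.ofReal_natCast]
  have hint : ENNReal.ofReal ((E - r) * R) + ENNReal.ofReal (s * b)
      ≤ ∫⁻ ω, ENNReal.ofReal (X ω) ∂ℙ + ENNReal.ofReal (s * b) := by
    rw [← ENNReal.ofReal_add hpos.le (by positivity)]
    calc ENNReal.ofReal ((E - r) * R + s * b)
        = ∫⁻ _, ENNReal.ofReal ((E - r) * R + s * b) ∂ℙ := by simp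
      _ ≤ ∫⁻ ω, (ENNReal.ofReal (X ω) + ENNReal.ofReal s * (H ω : ℝ≥0∞)) ∂ℙ := lintegral_mono hpt
      _ = ∫⁻ ω, ENNReal.ofReal (X ω) ∂ℙ + ENNReal.ofReal s * ∫⁻ ω, (H ω : ℝ≥0∞) ∂ℙ := by
          rw [lintegral_add_right _ (hHm.const_mul _), lintegral_const_mul _ hHm]
      _ ≤ _ := by
          rw [ENNReal.ofReal_mul hs]
          gcongr
  exact ENNReal.le_of_add_le_add_right ENNReal.ofReal_ne_top hint

lemma exp_neg_le_sq_pow {q h : ℝ} (hq : Real.exp (-h) ≤ q) (k : ℕ) :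
    Real.exp (-(2 * h * k)) ≤ (q ^ 2) ^ k := by
  have : Real.exp (-(2 * h * k)) = (Real.exp (-h) ^ 2) ^ k := by
    rw [← Real.exp_nat_mul, ← Real.exp_nat_mul]
    congr 1
    push_cast
    ring
  rw [this]
  gcongr

section Rates

variable {μ L : ℝ}

lemma one_add_sqrt_le (hμ : 0 < μ) (hL : μ ≤ L) :
    1 + Real.sqrt (2 * L ^ 2 / μ ^ 2 + 1) ≤ 3 * (L / μ) := by
  have h1 : 1 ≤ L / μ := (one_le_div hμ).2 hL
  have h2 : Real.sqrt (2 * L ^ 2 / μ ^ 2 + 1) ≤ 2 * (L / μ) := by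
    refine Real.sqrt_le_iff.2 ⟨by linarith, ?_⟩
    rw [mul_div_assoc, ← div_pow]
    nlinarith
  linarith

lemma communication_rate {χ : ℝ} {D : ℕ} (K : ℕ) (hμ : 0 < μ) (hL : μ ≤ L) (hχ : 1 ≤ χ)
    (hD : χ ≤ 9 * (D : ℝ) ^ 2) :
    2 * (μ / L) * (K / D : ℕ)
      ≤ 80 / (1 + Real.sqrt (2 * L ^ 2 / μ ^ 2 + 1)) * (K / Real.sqrt χ) := by
  have hL0 : 0 < L := hμ.trans_le hL
  have hχ0 : 0 < Real.sqrt χ := Real.sqrt_pos.2 (by linarith)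
  have hD0 : (0 : ℝ) < D := by
    have h0 : (0 : ℝ) ≤ D := D.cast_nonneg
    rcases h0.eq_or_lt with h | h
    · rw [← h] at hD; norm_num at hD; linarith
    · exact h
  have hsq : Real.sqrt χ ≤ 3 * D :=
    Real.sqrt_le_iff.2 ⟨by linarith, hD.trans_eq (by ring)⟩
  have hK : ((K / D : ℕ) : ℝ) ≤ 3 * (K / Real.sqrt χ) := by
    refine Nat.cast_div_le.trans ?_
    rw [← mul_div_assoc, div_le_div_iff₀ hD0 hχ0]
    have : (0 : ℝ) ≤ K := K.cast_nonneg
    nlinarith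
  have hQ : 6 * (μ / L) ≤ 80 / (1 + Real.sqrt (2 * L ^ 2 / μ ^ 2 + 1)) := by
    rw [le_div_iff₀ (by positivity)]
    calc 6 * (μ / L) * (1 + Real.sqrt (2 * L ^ 2 / μ ^ 2 + 1))
        ≤ 6 * (μ / L) * (3 * (L / μ)) := by
          have := one_add_sqrt_le hμ hL
          gcongr
      _ = 18 := by field_simp; norm_num
      _ ≤ 80 := by norm_num
  calc 2 * (μ / L) * (K / D : ℕ) ≤ 2 * (μ / L) * (3 * (K / Real.sqrt χ)) := by gcongr
    _ = 6 * (μ / L) * (K / Real.sqrt χ) := by ring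
    _ ≤ _ := by gcongr

lemma computation_rate {Lbar : ℝ} {n : ℕ} (N : ℕ) (hn : 0 < n) (hμ : 0 < μ) (hL : μ ≤ L)
    (hLbar : Lbar ^ 2 = n * L ^ 2) :
    2 * (μ / L) * (2 * N / n)
      ≤ 16 / (n + Real.sqrt (2 * n * Lbar ^ 2 / μ ^ 2 + (n : ℝ) ^ 2)) * N := by
  have hL0 : 0 < L := hμ.trans_le hL
  have hn0 : (0 : ℝ) < n := by exact_mod_cast hn
  have hs : Real.sqrt (2 * n * Lbar ^ 2 / μ ^ 2 + (n : ℝ) ^ 2)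
      = n * Real.sqrt (2 * L ^ 2 / μ ^ 2 + 1) := by
    have e : 2 * n * Lbar ^ 2 / μ ^ 2 + (n : ℝ) ^ 2 = (n : ℝ) ^ 2 * (2 * L ^ 2 / μ ^ 2 + 1) := by
      rw [hLbar]
      ring
    rw [e, Real.sqrt_mul (sq_nonneg _), Real.sqrt_sq hn0.le]
  have hQ : 4 * (μ / L) / n ≤ 16 / (n + n * Real.sqrt (2 * L ^ 2 / μ ^ 2 + 1)) := by
    rw [div_le_div_iff₀ hn0 (by positivity)]
    calc 4 * (μ / L) * (n + n * Real.sqrt (2 * L ^ 2 / μ ^ 2 + 1))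
        = 4 * (μ / L) * n * (1 + Real.sqrt (2 * L ^ 2 / μ ^ 2 + 1)) := by ring
      _ ≤ 4 * (μ / L) * n * (3 * (L / μ)) := by
          have := one_add_sqrt_le hμ hL
          gcongr
      _ = 12 * n := by field_simp; norm_num
      _ ≤ 16 * n := by linarith
  rw [hs]
  calc 2 * (μ / L) * (2 * N / n) = 4 * (μ / L) / n * N := by ring
    _ ≤ _ := by gcongr

end Rates

theorem theorem1 :
    ∃ c : ℝ, 0 < c ∧
      ∀ (Lbar μ χ : ℝ) (n K N : ℕ), 0 < μ → 0 < n → Real.sqrt n * μ ≤ Lbar → 1 ≤ χ →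
        ∀ L : ℝ, L = Lbar / Real.sqrt n →
          ∃ d₀ : ℕ, ∀ d : ℕ, d₀ ≤ d →
            ∃ (M : ℕ) (G : SimpleGraph (Fin M)) (W : Matrix (Fin M) (Fin M) ℝ)
              (P : VIProblem d M n) (zstar : Rd d),
              IsFixedNetwork G W χ ∧
              P.g = 0 ∧
              (∀ m, IsLipschitzOp L (P.node m)) ∧
              (∀ m, IsAverageLipschitz Lbar (P.comp m)) ∧
              (∀ m, ∃ ν : ℝ, 0 < ν ∧ IsStronglyMonotone ν (P.node m)) ∧
              IsStronglyMonotone μ P.total ∧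
              P.IsSolution zstar ∧
              zstar ≠ 0 ∧
              ∀ (Ω : Type u) [MeasurableSpace Ω] (ℙ : Measure Ω) [IsProbabilityMeasure ℙ]
                (A : Procedure P G K N Ω ℙ),
                ENNReal.ofReal
                    (c * Real.exp (-(80 / (1 + Real.sqrt (2 * L ^ 2 / μ ^ 2 + 1))) *
                      (K / Real.sqrt χ)) * ‖(0 : Rd d) - zstar‖ ^ 2)
                  ≤ ∫⁻ ω, ENNReal.ofReal (‖A.out ω - zstar‖ ^ 2) ∂ℙ ∧
                ENNReal.ofReal
                    (c * Real.exp (-(16 / (n + Real.sqrt (2 * n * Lbar ^ 2 / μ ^ 2 + (n : ℝ) ^ 2))) *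
                      N) * ‖(0 : Rd d) - zstar‖ ^ 2)
                  ≤ ∫⁻ ω, ENNReal.ofReal (‖A.out ω - zstar‖ ^ 2) ∂ℙ := by
  refine ⟨Real.exp (-4) / 2, by positivity, ?_⟩
  intro Lbar μ χ n K N hμ hn hLbar hχ L hLdef
  have hn0 : (0 : ℝ) < n := by exact_mod_cast hn
  have hsn : 0 < Real.sqrt n := Real.sqrt_pos.2 hn0
  have hμL : μ ≤ L := by
    rw [hLdef, le_div_iff₀ hsn, mul_comm]
    exact hLbar
  have hL0 : 0 < L := hμ.trans_le hμL
  have hLbar2 : Lbar ^ 2 = n * L ^ 2 := by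
    rw [hLdef, div_pow, Real.sq_sqrt hn0.le, mul_div_cancel₀ _ hn0.ne']
  obtain ⟨q, hq0, hq1, hqeq, hqexp⟩ := exists_chain_rate hμ hμL
  obtain ⟨M, G, W, hM3, hW, hG, hD⟩ := exists_network χ hχ
  have hM0 : (0 : ℝ) < M := by
    have : 0 < M := by omega
    exact_mod_cast this
  have hh0 : 0 < μ / L := by positivity
  have hh1 : μ / L ≤ 1 := (div_le_one hL0).2 hμL
  have ha1 := communication_rate (D := M / 2) K hμ hμL hχ hD
  have ha2 := computation_rate N hn hμ hμL hLbar2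
  simp only [neg_mul]
  set a₁ := 80 / (1 + Real.sqrt (2 * L ^ 2 / μ ^ 2 + 1)) * (K / Real.sqrt χ)
  set a₂ := 16 / (n + Real.sqrt (2 * n * Lbar ^ 2 / μ ^ 2 + (n : ℝ) ^ 2)) * N
  have hq2 : q ^ 2 < 1 := by nlinarith
  -- The dimension is so large that truncating the chain costs at most half of either bound.
  obtain ⟨d₁, hd₁⟩ := exists_pow_lt_of_lt_one
    (show 0 < Real.exp (-4) / 2 * min (Real.exp (-a₁)) (Real.exp (-a₂)) by positivity) hq2
  refine ⟨d₁ + 1, fun d hd => ?_⟩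
  have hpow : (q ^ 2) ^ d ≤ Real.exp (-4) / 2 * min (Real.exp (-a₁)) (Real.exp (-a₂)) :=
    (pow_le_pow_of_le_one (sq_nonneg q) hq2.le (by omega)).trans hd₁.le
  have hpow1 : (q ^ 2) ^ d ≤ Real.exp (-4) / 2 * Real.exp (-a₁) :=
    hpow.trans (by gcongr; exact min_le_left _ _)
  have hpow2 : (q ^ 2) ^ d ≤ Real.exp (-4) / 2 * Real.exp (-a₂) :=
    hpow.trans (by gcongr; exact min_le_right _ _)
  refine ⟨M, G, W, chainProblem d M n μ (L / 2) q, geomVec d q, hW, rfl,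
    chainProblem_node_lipschitz hn (by omega) hμ hμL hq0.le hq1.le,
    chainProblem_averageLipschitz hn (by omega) hμ hμL hLbar2 hq0.le hq1.le,
    fun m => ⟨μ / M, by positivity,
      chainProblem_node_stronglyMonotone hn (by positivity) hq0.le m⟩,
    chainProblem_total_stronglyMonotone hn (by omega) (by positivity) hq0.le,
    chainProblem_isSolution hn (by omega) hqeq, ?_, ?_⟩
  · intro h
    have := congrArg (fun z : Rd d => z ⟨0, by omega⟩) h
    simp [geomVec] at this
  intro Ω _ ℙ _ A
  rw [zero_sub, norm_neg]
  constructor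
  · refine ofReal_le_lintegral_of_le fun ω => ?_
    refine le_trans ?_ (norm_sub_geomVec_sq_ge hq0 hq1 (A.out_mem_of_rounds hM3 hG ω))
    gcongr
    have h1 : Real.exp (-4) * Real.exp (-a₁) ≤ (q ^ 2) ^ (K / (M / 2) + 2) := by
      refine le_trans ?_ (exp_neg_le_sq_pow hqexp _)
      rw [← Real.exp_add, Real.exp_le_exp, Nat.cast_add, Nat.cast_ofNat]
      linarith
    linarith
  · have hH : ∫⁻ ω, (A.hits A.T ω : ℝ≥0∞) ∂ℙ ≤ ENNReal.ofReal (2 * N / n) := by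
      rw [ENNReal.ofReal_div_of_pos hn0, ENNReal.ofReal_mul zero_le_two, ENNReal.ofReal_natCast,
        ENNReal.ofReal_natCast, ENNReal.ofReal_ofNat,
        ENNReal.le_div_iff_mul_le (Or.inl (by exact_mod_cast hn.ne'))
          (Or.inl (ENNReal.natCast_ne_top n)), mul_comm]
      exact A.natCast_mul_lintegral_hits_le hn
    refine le_trans (ENNReal.ofReal_le_ofReal ?_) (ofReal_exp_le_lintegral (a := 2 * (μ / L))
      (r := (q ^ 2) ^ d) (R := ‖geomVec d q‖ ^ 2) (by positivity) (by positivity) (by positivity)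
      (A.measurable_hits hn A.T) hH fun ω => ?_)
    · gcongr
      have h1 : Real.exp (-4) * Real.exp (-a₂)
          ≤ Real.exp (-(2 * (μ / L) * (2 * N / n + 1))) := by
        rw [← Real.exp_add, Real.exp_le_exp]
        linarith
      linarith
    · refine le_trans ?_ (norm_sub_geomVec_sq_ge hq0 hq1 (A.out_mem_of_hits (by omega) ω))
      gcongr
      have := exp_neg_le_sq_pow hqexp (A.hits A.T ω + 1)
      push_cast at this
      exact this
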